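/- **Setting.** Let $\mathcal X$ be a measurable space. A (symmetric) regression algorithm $\mathcal A$ assigns to each sample $D\in(\mathcal X\times\mathbb R)^n$, $n\ge 0$, a function $\mathcal A(D):\mathcal X\to\mathbb R$, invariant under permutations of the sample and such that $(D,x)\mapsto\mathcal A(D)(x)$ is measurable for every $n$. Let $P$ be a probability distribution on $\mathcal X\times\mathbb R$, let $\alpha\in[0,1]$, and let $\mathcal D_n=((X_1,Y_1),\dots,(X_n,Y_n))$ with i.i.d. points drawn from $P$. Put $\widehat\mu_{-i}=\mathcal A(\mathcal D_n\setminus\{(X_i,Y_i)\})$ and $R_i=|Y_i-\widehat\mu_{-i}(X_i)|$. For $v_1,\dots,v_n\in\mathbb R$ let $\mathrm{Quantile}(\{v_i\};\tau)=\inf\{t: \frac1n\#\{i:v_i\le t\}\ge\tau\}\in[-\infty,\infty]$ (so it is $+\infty$ for $\tau>1$). For $\gamma\ge0$ the $\gamma$-inflated jackknife+ interval is $$\widehat C_n^{\gamma\text{-J+}}(x)=\Big[-\mathrm{Quantile}\big(\{-\widehat\mu_{-i}(x)+R_i\}_{i\le n};(1-\alpha)(1+\tfrac1n)\big)-\gamma,\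 \mathrm{Quantile}\big(\{\widehat\mu_{-i}(x)+R_i\}_{i\le n};(1-\alpha)(1+\tfrac1n)\big)+\gamma\Big],$$ and its training-conditional miscoverage rate is $\alpha_P^{\gamma\text{-J+}}(\mathcal D_n)=\mathbb P\{Y\notin\widehat C_n^{\gamma\text{-J+}}(X)\mid\mathcal D_n\}$ with $(X,Y)\sim P$ independent of $\mathcal D_n$. Write $\alpha_P^{\text{J+}}$ for the case $\gamma=0$. For $n\ge m\ge0$ the out-of-sample $m$-swap-stability is $$\bar\beta^{\rm out}_{m,n}(\mathcal A,P)=\mathbb E\big|\widehat\mu_n(X)-\widehat\mu_n'(X)\big|\in[0,\infty],$$ where $\widehat\mu_n=\mathcal A((X_1,Y_1),\dots,(X_n,Y_n))$, $\widehat\mu'_n=\mathcal A((X_1,Y_1),\dots,(X_{n-m},Y_{n-m}),(X'_{n-m+1},Y'_{n-m+1}),\dots,(X'_n,Y'_n))$ and all points $(X,Y),(X_i,Y_i),(X_i',Y_i')$ are i.i.d. from $P$; put $\bar\beta^{*,\rm out}_{1,n}=\sup_{n'\ge n}\bar\beta^{\rm out}_{1,n'}$. **Theorem.** (1) For all $P$,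 $\mathcal A$, all $n,m$ with $1\le m\le n-1$, all $\gamma>0$ and $\delta\in(0,1)$, $$\mathbb P\Big\{\alpha_P^{\gamma\text{-J+}}(\mathcal D_n)<\alpha+3\sqrt{\tfrac{\log(1/\delta)}{2\min\{n,m\}}}+2\sqrt[3]{\tfrac{2\bar\beta^{\rm out}_{m,n-1}(\mathcal A,P)}{\gamma}}\Big\}\ge1-3\delta-\sqrt[3]{\tfrac{2\bar\beta^{\rm out}_{m,n-1}(\mathcal A,P)}{\gamma}}.$$ (2) If moreover the conditional distribution of $Y$ given $X$ has a density $f_{Y|X}$ with respect to Lebesgue measure, and $B_{\rm dens}=\mathbb E[\sup_{y}f_{Y|X}(y\mid X)]\in[0,\infty]$, then for all $n,m$ with $1\le m\le n-1$ and all $\delta\in(0,1)$, with the convention $\infty\cdot0=0$, $$\mathbb P\Big\{\alpha_P^{\text{J+}}(\mathcal D_n)<\alpha+3\sqrt{\tfrac{\log(1/\delta)}{2\min\{n,m\}}}+4\sqrt[4]{2B_{\rm dens}\,\bar\beta^{\rm out}_{m,n-1}(\mathcal A,P)}\Big\}\ge1-3\delta-\sqrt[4]{2B_{\rm dens}\,\bar\beta^{\rm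 out}_{m,n-1}(\mathcal A,P)}.$$ (3) For any sequences $b_n,\gamma_n>0$ with $b_n/\gamma_n\to0$ there is a sequence $\epsilon_n\to0$, not depending on $\alpha$, such that for every $\alpha\in[0,1]$ $$\lim_{n\to\infty}\ \sup_{\mathcal A,P:\ \bar\beta^{*,\rm out}_{1,n-1}(\mathcal A,P)\le b_n}\mathbb P\{\alpha_P^{\gamma_n\text{-J+}}(\mathcal D_n)\ge\alpha+\epsilon_n\}=0.$$ (4) For $B>0$ let $\mathcal P_B$ be the set of distributions $P$ for which $Y$ given $X$ has a conditional density with $\mathbb E[\sup_yf_{Y|X}(y\mid X)]\le B$. For any sequences $b_n,B_n>0$ with $b_nB_n\to0$ there is a sequence $\epsilon_n\to0$, not depending on $\alpha$, such that for every $\alpha\in[0,1]$ $$\lim_{n\to\infty}\ \sup_{\mathcal A,\ P\in\mathcal P_{B_n}:\ \bar\beta^{*,\rm out}_{1,n-1}(\mathcal A,P)\le b_n}\mathbb P\{\alpha_P^{\text{J+}}(\mathcal D_n)\ge\alpha+\epsilon_n\}=0.$$ -/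

import Mathlib

open MeasureTheory Filter Topology
open scoped ENNReal

/-- A symmetric regression algorithm: for every sample size `n`, a map sending a training sample
in `(𝒳 × ℝ)ⁿ` to a fitted regression function `𝒳 → ℝ`, invariant under permutations of the sample.
Measurability is joint in the sample and the evaluation point, so that in particular each fitted
function is measurable and all expectations and probabilities below make sense. -/
structure RegressionAlgorithm (𝒳 : Type*) [MeasurableSpace 𝒳] where
  /-- the fitted regression function on a sample of size `n` -/
  fit : (n : ℕ) → (Fin n → 𝒳 × ℝ) → 𝒳 → ℝ
  measurable_fit : ∀ n, Measurable fun p : (Fin n → 𝒳 × ℝ) × 𝒳 => fit n p.1 p.2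
  symmetric : ∀ (n : ℕ) (π : Equiv.Perm (Fin n)) (D : Fin n → 𝒳 × ℝ),
    fit n (fun i => D (π i)) = fit n D

/-- The empirical quantile `inf {t : #{i : vᵢ ≤ t} / n ≥ τ}` of a list of `n` real values, as an
extended real. It is `+∞` for `τ > 1`; for `0 < τ ≤ 1` and `n ≥ 1` it is the `⌈τ n⌉`-th smallest
value. -/
noncomputable def quantile {n : ℕ} (v : Fin n → ℝ) (τ : ℝ) : EReal :=
  sInf {t : EReal | τ * (n : ℝ) ≤ (Nat.card {i : Fin n // (v i : EReal) ≤ t} : ℝ)}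

/-- The sample of size `n - 1` obtained by deleting the `i`-th point of a sample of size `n`. -/
def leaveOneOut {Z : Type*} {n : ℕ} (D : Fin n → Z) (i : Fin n) : Fin (n - 1) → Z := fun j =>
  if (j : ℕ) < (i : ℕ) then D ⟨j, by omega⟩ else D ⟨j + 1, by omega⟩

/-- The law of `n` i.i.d. points drawn from `P`. -/
noncomputable def iidLaw {Z : Type*} [MeasurableSpace Z] (P : Measure Z) (n : ℕ) :
    Measure (Fin n → Z) :=
  Measure.pi fun _ => P

namespace RegressionAlgorithm

variable {𝒳 : Type*} [MeasurableSpace 𝒳]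

/-- The leave-one-out model `μ̂₋ᵢ`. -/
def looFit (A : RegressionAlgorithm 𝒳) {n : ℕ} (D : Fin n → 𝒳 × ℝ) (i : Fin n) : 𝒳 → ℝ :=
  A.fit (n - 1) (leaveOneOut D i)

/-- The leave-one-out residual `Rᵢ = |Yᵢ - μ̂₋ᵢ(Xᵢ)|`. -/
def looResidual (A : RegressionAlgorithm 𝒳) {n : ℕ} (D : Fin n → 𝒳 × ℝ) (i : Fin n) : ℝ :=
  |(D i).2 - A.looFit D i (D i).1|

/-- The jackknife+ prediction interval at level `1 - α`, inflated by `γ`, trained on the sample `D`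
and evaluated at the test feature `x`. The usual jackknife+ interval is the case `γ = 0`. -/
def jackknifePlus (A : RegressionAlgorithm 𝒳) {n : ℕ} (α γ : ℝ) (D : Fin n → 𝒳 × ℝ) (x : 𝒳) :
    Set ℝ :=
  {y : ℝ |
    -quantile (fun i => -A.looFit D i x + A.looResidual D i) ((1 - α) * (1 + 1 / (n : ℝ)))
        - (γ : EReal) ≤ (y : EReal) ∧
    (y : EReal) ≤
      quantile (fun i => A.looFit D i x + A.looResidual D i) ((1 - α) * (1 + 1 / (n : ℝ)))
        + (γ : EReal)}

/-- The training-conditional miscoverage rate of the `γ`-inflated jackknife+ interval: the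
probability, over a new point `(X, Y) ∼ P` independent of the training sample `D`, that the interval
trained on `D` misses `Y`. -/
noncomputable def miscoverage (A : RegressionAlgorithm 𝒳) (P : Measure (𝒳 × ℝ)) {n : ℕ} (α γ : ℝ)
    (D : Fin n → 𝒳 × ℝ) : ℝ≥0∞ :=
  P {z | z.2 ∉ A.jackknifePlus α γ D z.1}

end RegressionAlgorithm

/-- The sample `D` with its last `m` points replaced by the corresponding points of `D'`. -/
def swapLast {Z : Type*} {n : ℕ} (m : ℕ) (D D' : Fin n → Z) : Fin n → Z := fun j =>
  if (j : ℕ) < n - m then D j else D' j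

/-- Out-of-sample `m`-swap-stability at sample size `n` (meaningful for `m ≤ n`): the expectation of
`|μ̂ₙ(X) - μ̂ₙ'(X)|`, where `μ̂ₙ` is fitted to `n` points, `μ̂ₙ'` to the same sample with its last `m`
points replaced by fresh ones, and `X` is the feature of an independent test point. -/
noncomputable def swapStability {𝒳 : Type*} [MeasurableSpace 𝒳] (A : RegressionAlgorithm 𝒳)
    (P : Measure (𝒳 × ℝ)) (m n : ℕ) : ℝ≥0∞ :=
  ∫⁻ ω : (Fin n → 𝒳 × ℝ) × (Fin n → 𝒳 × ℝ) × (𝒳 × ℝ),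
    ENNReal.ofReal |A.fit n ω.1 ω.2.2.1 - A.fit n (swapLast m ω.1 ω.2.1) ω.2.2.1|
      ∂((iidLaw P n).prod ((iidLaw P n).prod P))

/-- `sup_{n' ≥ n}` of the out-of-sample `1`-swap-stability at sample size `n'`. -/
noncomputable def swapStabilitySup {𝒳 : Type*} [MeasurableSpace 𝒳] (A : RegressionAlgorithm 𝒳)
    (P : Measure (𝒳 × ℝ)) (n : ℕ) : ℝ≥0∞ :=
  ⨆ (n' : ℕ) (_ : n ≤ n'), swapStability A P 1 n'

/-- `f x y` is a (jointly measurable) conditional density, with respect to Lebesgue measure, of `Y`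
at `y` given `X = x`, for `(X, Y) ∼ P`: that is, `P(dx, dy) = P_X(dx) f(x, y) dy`. -/
def IsCondDensity {𝒳 : Type*} [MeasurableSpace 𝒳] (P : Measure (𝒳 × ℝ)) (f : 𝒳 → ℝ → ℝ≥0∞) :
    Prop :=
  Measurable (Function.uncurry f) ∧
    P = (P.fst.prod (volume : Measure ℝ)).withDensity (Function.uncurry f)

/-- `E[sup_y f(X, y)]`, the expectation being over the marginal law of `X`. -/
noncomputable def expSupDensity {𝒳 : Type*} [MeasurableSpace 𝒳] (P : Measure (𝒳 × ℝ))
    (f : 𝒳 → ℝ → ℝ≥0∞) : ℝ≥0∞ :=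
  ∫⁻ x, ⨆ y : ℝ, f x y ∂P.fst

/-- `Y ∣ X` has a conditional density with `E[sup_y f(X, y)] ≤ B`. -/
def HasBoundedCondDensity {𝒳 : Type*} [MeasurableSpace 𝒳] (P : Measure (𝒳 × ℝ)) (B : ℝ) : Prop :=
  ∃ f : 𝒳 → ℝ → ℝ≥0∞, IsCondDensity P f ∧ expSupDensity P f ≤ ENNReal.ofReal B

/-! ### Subsamples of an i.i.d. pool and the swap distance -/

section Resampling

variable {Z : Type*} [MeasurableSpace Z] (P : Measure Z) [IsProbabilityMeasure P]

/-! The training sample is enlarged by `m` ghost test points. In the pool of `n + m` points, the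
prediction at point `i` is averaged over all samples of size `n - 1` drawn from the other points
(`poolFit`). The resulting pooled residuals commute with permutations of the pool, so their ranks
are exchangeable.

Stability ties the leave-one-out models to this pooled model. Two samples of size `n - 1` avoiding a
pool point share all but at most `m` of their points, so at that point their predictions differ on
average by at most the `m`-swap-stability `β`. This requires that swapping fewer points costs no
more than swapping `m`, which is `swapDist_mono`; it rests on nonnegativity of the energy distance,
`E|X - X'| + E|Y - Y'| ≤ 2 E|X - Y|`.

By Markov, a (training, test) pair has discrepancy above `γ` with probability at most `2β/γ = a³`.
Markov twice more: outside an event of probability `a`, all but a fraction `a` of the test points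
see at most a fraction `a` of bad training points. A missed test point of the good kind has a pooled
residual exceeding at least `(1 - α - a) n` training ones. Hoeffding's inequality without
replacement, applied to low ranks in the training part and to high ranks in the test part, limits
how many test points can do this; Hoeffding for the i.i.d. test points passes from the observed
fraction to the miscoverage. Three deviations `ε`, each failing with probability at most `δ`, and
twice `a` give the bound (`measure_le_miscoverage_le`).

With a conditional density, removing the inflation costs at most `2 B γ`, and `γ` is chosen to
balance this against `a`. For the limits, `β` at swap size `m` is at most `m` times its value at
swap size `1`, and `m` grows slowly. -/

theorem measurePreserving_comp_injective {ι κ : Type*} [Fintype ι] [Fintype κ] {u : κ → ι}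
    (hu : Function.Injective u) :
    MeasurePreserving (fun D : ι → Z => D ∘ u) (Measure.pi fun _ => P)
      (Measure.pi fun _ => P) := by
  classical
  have hm : Measurable (fun D : ι → Z => D ∘ u) :=
    measurable_pi_lambda _ fun k => measurable_pi_apply (u k)
  refine ⟨hm, (Measure.pi_eq fun s hs => ?_).symm⟩
  rw [Measure.map_apply hm (MeasurableSet.univ_pi hs)]
  have hpre : (fun D : ι → Z => D ∘ u) ⁻¹' Set.univ.pi s =
      Set.univ.pi fun i => ⋂ (k : κ) (_ : u k = i), s k := by
    ext D
    simp only [Set.mem_preimage, Set.mem_univ_pi, Set.mem_iInter, Function.comp_apply]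
    exact ⟨fun h i k hk => hk ▸ h k, fun h k => h (u k) k rfl⟩
  rw [hpre, Measure.pi_pi]
  -- Coordinates outside the range of `u` are unconstrained, so they contribute a factor `1`.
  have h1 : ∀ i, i ∉ Finset.univ.image u → P (⋂ (k : κ) (_ : u k = i), s k) = 1 := by
    intro i hi
    have : (⋂ (k : κ) (_ : u k = i), s k) = Set.univ := by
      simp only [Finset.mem_image, Finset.mem_univ, true_and, not_exists] at hi
      simp [hi]
    rw [this, measure_univ]
  rw [← Finset.prod_subset (Finset.subset_univ (Finset.univ.image u)) fun i _ hi => h1 i hi,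
    Finset.prod_image fun a _ b _ h => hu h]
  refine Finset.prod_congr rfl fun k _ => ?_
  congr 1
  ext z
  simp only [Set.mem_iInter]
  exact ⟨fun h => h k rfl, fun h k' hk' => hu hk' ▸ h⟩

theorem lintegral_comp_injective {ι κ : Type*} [Fintype ι] [Fintype κ] {u : κ → ι}
    (hu : Function.Injective u) {F : (κ → Z) → ℝ≥0∞} (hF : Measurable F) :
    ∫⁻ D : ι → Z, F (D ∘ u) ∂(Measure.pi fun _ => P) = ∫⁻ D, F D ∂(Measure.pi fun _ => P) :=
  (measurePreserving_comp_injective P hu).lintegral_comp hF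

/-- The sample `D` with the points indexed by `s` replaced by the corresponding points of `D'`. -/
def mixOn {κ : Type*} [DecidableEq κ] (s : Finset κ) (D D' : κ → Z) : κ → Z := fun j =>
  if j ∈ s then D' j else D j

theorem measurable_mixOn {κ : Type*} [DecidableEq κ] (s : Finset κ) {Ω : Type*}
    [MeasurableSpace Ω] {D D' : Ω → κ → Z} (hD : Measurable D) (hD' : Measurable D') :
    Measurable fun ω => mixOn s (D ω) (D' ω) := by
  refine measurable_pi_lambda _ fun j => ?_
  unfold mixOn
  split_ifs
  · exact (measurable_pi_apply j).comp hD'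
  · exact (measurable_pi_apply j).comp hD

/-- The expected change of `f`, at an independent point, when the points of its sample indexed by
`s` are replaced by fresh ones. -/
noncomputable def swapDist {p : ℕ} (f : (Fin p → Z) → Z → ℝ) (s : Finset (Fin p)) : ℝ≥0∞ :=
  ∫⁻ ω : (Fin p → Z) × (Fin p → Z) × Z,
    ENNReal.ofReal |f ω.1 ω.2.2 - f (mixOn s ω.1 ω.2.1) ω.2.2|
      ∂((Measure.pi fun _ => P).prod ((Measure.pi fun _ => P).prod P))

variable {P}

/-- Disjoint sets of positions in an i.i.d. pool carry independent samples; the three index maps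
glue to one injection from a sum type. -/
theorem measurePreserving_split {ι κ κ' : Type*} [Fintype ι] [Fintype κ] [Fintype κ']
    {u : κ → ι} {v : κ' → ι} {i : ι} (hu : Function.Injective u) (hv : Function.Injective v)
    (huv : ∀ a b, u a ≠ v b) (hui : ∀ a, u a ≠ i) (hvi : ∀ b, v b ≠ i) :
    MeasurePreserving (fun D : ι → Z => ((D ∘ u, D ∘ v, D i) : (κ → Z) × (κ' → Z) × Z))
      (Measure.pi fun _ => P) ((Measure.pi fun _ => P).prod ((Measure.pi fun _ => P).prod P)) := by
  have h1 := measurePreserving_comp_injective P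
    (u := Sum.elim u (Sum.elim v fun _ : Unit => i)) (by
      rintro (a | a | a) (b | b | b) h <;> simp only [Sum.elim_inl, Sum.elim_inr] at h
      · rw [hu h]
      · exact (huv _ _ h).elim
      · exact (hui _ h).elim
      · exact (huv _ _ h.symm).elim
      · rw [hv h]
      · exact (hvi _ h).elim
      · exact (hui _ h.symm).elim
      · exact (hvi _ h.symm).elim
      · rfl)
  have h2 := measurePreserving_sumPiEquivProdPi (fun _ : κ ⊕ (κ' ⊕ Unit) => P)
  have h3 := measurePreserving_sumPiEquivProdPi (fun _ : κ' ⊕ Unit => P)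
  have h4 := measurePreserving_funUnique P Unit
  have h5 := (MeasurePreserving.id (Measure.pi fun _ : κ => P)).prod
    (((MeasurePreserving.id (Measure.pi fun _ : κ' => P)).prod h4).comp h3)
  exact h5.comp (h2.comp h1)

/-- Only the overlap pattern of the two samples matters, not where they sit in the pool. Every
comparison of models below reaches `swapDist` through this identity. -/
theorem lintegral_pair_eq_swapDist {p : ℕ} {f : (Fin p → Z) → Z → ℝ}
    (hf : Measurable fun q : (Fin p → Z) × Z => f q.1 q.2) {s : Finset (Fin p)}
    {ι : Type*} [Fintype ι] {e e' : Fin p → ι} {i : ι} (he : Function.Injective e)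
    (he' : Function.Injective e') (hei : ∀ j, e j ≠ i) (hei' : ∀ j, e' j ≠ i)
    (hs : ∀ j, j ∉ s → e' j = e j) (hs' : ∀ j ∈ s, ∀ k, e k ≠ e' j) :
    ∫⁻ D : ι → Z, ENNReal.ofReal |f (D ∘ e) (D i) - f (D ∘ e') (D i)| ∂(Measure.pi fun _ => P) =
      swapDist P f s := by
  classical
  -- `swapDist` integrates over a whole second sample but uses only its coordinates in `s`; the idle
  -- coordinates are drawn from an extra copy of `Fin p` adjoined to the pool.
  let v : Fin p → ι ⊕ Fin p := fun j => if j ∈ s then Sum.inl (e' j) else Sum.inr j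
  have hmp := measurePreserving_split (P := P) (u := fun j => (Sum.inl (e j) : ι ⊕ Fin p)) (v := v)
    (i := Sum.inl i)
    (fun a b h => he (Sum.inl_injective h))
    (by
      intro a b h
      simp only [v] at h
      split_ifs at h with h1 h2 h2
      · exact he' (Sum.inl_injective h)
      · exact Sum.inr_injective h)
    (by
      intro a b h
      simp only [v] at h
      split_ifs at h with h1
      exact hs' b h1 a (Sum.inl_injective h))
    (fun a h => hei a (Sum.inl_injective h))
    (by
      intro b h
      simp only [v] at h
      split_ifs at h with h1
      exact hei' b (Sum.inl_injective h))
  have hF : Measurable fun ω : (Fin p → Z) × (Fin p → Z) × Z =>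
      ENNReal.ofReal |f ω.1 ω.2.2 - f (mixOn s ω.1 ω.2.1) ω.2.2| := by
    have h1 := hf.comp (measurable_fst.prodMk measurable_snd.snd :
      Measurable fun ω : (Fin p → Z) × (Fin p → Z) × Z => (ω.1, ω.2.2))
    have h2 := hf.comp ((measurable_mixOn s measurable_fst measurable_snd.fst).prodMk
      measurable_snd.snd :
      Measurable fun ω : (Fin p → Z) × (Fin p → Z) × Z => (mixOn s ω.1 ω.2.1, ω.2.2))
    exact (measurable_norm.comp (h1.sub h2)).ennreal_ofReal
  have hG : Measurable fun D : ι → Z =>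
      ENNReal.ofReal |f (D ∘ e) (D i) - f (D ∘ e') (D i)| := by
    have h1 (e : Fin p → ι) := hf.comp ((measurable_pi_lambda _ fun j =>
      measurable_pi_apply (e j)).prodMk (measurable_pi_apply i) :
      Measurable fun D : ι → Z => (D ∘ e, D i))
    exact (measurable_norm.comp ((h1 e).sub (h1 e'))).ennreal_ofReal
  rw [swapDist, ← hmp.lintegral_comp hF,
    ← lintegral_comp_injective P (Sum.inl_injective (β := Fin p)) hG]
  refine lintegral_congr fun D => ?_
  have : mixOn s (D ∘ fun j => (Sum.inl (e j) : ι ⊕ Fin p)) (D ∘ v) = (D ∘ Sum.inl) ∘ e' := by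
    funext j
    by_cases h : j ∈ s
    · simp [mixOn, v, h]
    · simp [mixOn, h, hs j h]
  simp only [this]
  rfl

end Resampling

/-! ### Energy distance on the line -/

section Energy

/-- The distance is the length of the set of thresholds `t` that separate `x` from `y`. -/
theorem ofReal_abs_sub_eq_lintegral (x y : ℝ) :
    ENNReal.ofReal |x - y| =
      ∫⁻ t : ℝ, ((Set.Iic t).indicator 1 x * (Set.Ioi t).indicator 1 y +
        (Set.Ioi t).indicator 1 x * (Set.Iic t).indicator 1 y) := by
  have key : ∀ t : ℝ, ((Set.Iic t).indicator (1 : ℝ → ℝ≥0∞) x * (Set.Ioi t).indicator 1 y +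
        (Set.Ioi t).indicator 1 x * (Set.Iic t).indicator 1 y) =
      (Set.Ico (min x y) (max x y)).indicator 1 t := by
    intro t
    simp only [Set.indicator_apply, Set.mem_Iic, Set.mem_Ioi, Set.mem_Ico, Pi.one_apply]
    rcases le_total x y with h | h
    · rw [min_eq_left h, max_eq_right h]
      split_ifs <;> simp <;> grind
    · rw [min_eq_right h, max_eq_left h]
      split_ifs <;> simp <;> grind
  simp_rw [key]
  rw [lintegral_indicator_one measurableSet_Ico, Real.volume_Ico, max_sub_min_eq_abs, abs_sub_comm]

theorem measurable_indicator_Iic :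
    Measurable fun q : ℝ × ℝ => (Set.Iic q.2).indicator (1 : ℝ → ℝ≥0∞) q.1 := by
  have : (fun q : ℝ × ℝ => (Set.Iic q.2).indicator (1 : ℝ → ℝ≥0∞) q.1) =
      {q : ℝ × ℝ | q.1 ≤ q.2}.indicator 1 := by
    funext q; simp [Set.indicator_apply]
  rw [this]
  exact measurable_one.indicator (measurableSet_le measurable_fst measurable_snd)

theorem measurable_indicator_Ioi :
    Measurable fun q : ℝ × ℝ => (Set.Ioi q.2).indicator (1 : ℝ → ℝ≥0∞) q.1 := by
  have : (fun q : ℝ × ℝ => (Set.Ioi q.2).indicator (1 : ℝ → ℝ≥0∞) q.1) =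
      {q : ℝ × ℝ | q.2 < q.1}.indicator 1 := by
    funext q; simp [Set.indicator_apply]
  rw [this]
  exact measurable_one.indicator (measurableSet_lt measurable_snd measurable_fst)

theorem lintegral_lintegral_abs_sub (μ ν : Measure ℝ) [IsProbabilityMeasure μ]
    [IsProbabilityMeasure ν] :
    ∫⁻ x, ∫⁻ y, ENNReal.ofReal |x - y| ∂ν ∂μ =
      ∫⁻ t : ℝ, (μ (Set.Iic t) * ν (Set.Ioi t) + μ (Set.Ioi t) * ν (Set.Iic t)) := by
  simp_rw [ofReal_abs_sub_eq_lintegral]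
  have hm : Measurable fun q : (ℝ × ℝ) × ℝ =>
      ((Set.Iic q.2).indicator (1 : ℝ → ℝ≥0∞) q.1.1 * (Set.Ioi q.2).indicator 1 q.1.2 +
        (Set.Ioi q.2).indicator 1 q.1.1 * (Set.Iic q.2).indicator 1 q.1.2) := by
    have a1 := measurable_indicator_Iic.comp ((measurable_fst.fst).prodMk measurable_snd :
      Measurable fun q : (ℝ × ℝ) × ℝ => (q.1.1, q.2))
    have a2 := measurable_indicator_Iic.comp ((measurable_fst.snd).prodMk measurable_snd :
      Measurable fun q : (ℝ × ℝ) × ℝ => (q.1.2, q.2))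
    have a3 := measurable_indicator_Ioi.comp ((measurable_fst.fst).prodMk measurable_snd :
      Measurable fun q : (ℝ × ℝ) × ℝ => (q.1.1, q.2))
    have a4 := measurable_indicator_Ioi.comp ((measurable_fst.snd).prodMk measurable_snd :
      Measurable fun q : (ℝ × ℝ) × ℝ => (q.1.2, q.2))
    exact (a1.mul a4).add (a3.mul a2)
  rw [← lintegral_prod (μ := μ) (ν := ν) (fun q : ℝ × ℝ => ∫⁻ t : ℝ,
      ((Set.Iic t).indicator (1 : ℝ → ℝ≥0∞) q.1 * (Set.Ioi t).indicator 1 q.2 +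
        (Set.Ioi t).indicator 1 q.1 * (Set.Iic t).indicator 1 q.2))
      (hm.lintegral_prod_right').aemeasurable]
  rw [lintegral_lintegral_swap hm.aemeasurable]
  refine lintegral_congr fun t => ?_
  have m1 : Measurable ((Set.Iic t).indicator (1 : ℝ → ℝ≥0∞)) :=
    measurable_one.indicator measurableSet_Iic
  have m2 : Measurable ((Set.Ioi t).indicator (1 : ℝ → ℝ≥0∞)) :=
    measurable_one.indicator measurableSet_Ioi
  have m3 : Measurable fun q : ℝ × ℝ =>
      (Set.Iic t).indicator (1 : ℝ → ℝ≥0∞) q.1 * (Set.Ioi t).indicator 1 q.2 :=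
    (m1.comp measurable_fst).mul (m2.comp measurable_snd)
  rw [lintegral_add_left m3,
    lintegral_prod_mul m1.aemeasurable m2.aemeasurable,
    lintegral_prod_mul m2.aemeasurable m1.aemeasurable]
  simp

/-- With `u`, `v` the two distribution functions at `t`, the integrands differ by `2 (u - v)²`. -/
theorem energy_le (μ ν : Measure ℝ) [IsProbabilityMeasure μ] [IsProbabilityMeasure ν] :
    ∫⁻ x, ∫⁻ y, ENNReal.ofReal |x - y| ∂μ ∂μ + ∫⁻ x, ∫⁻ y, ENNReal.ofReal |x - y| ∂ν ∂ν ≤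
      2 * ∫⁻ x, ∫⁻ y, ENNReal.ofReal |x - y| ∂ν ∂μ := by
  simp_rw [lintegral_lintegral_abs_sub]
  have hmI (μ : Measure ℝ) [IsProbabilityMeasure μ] : Measurable fun t : ℝ => μ (Set.Iic t) :=
    Monotone.measurable fun a b h => measure_mono (Set.Iic_subset_Iic.2 h)
  have hmO (μ : Measure ℝ) [IsProbabilityMeasure μ] : Measurable fun t : ℝ => μ (Set.Ioi t) :=
    Antitone.measurable fun a b h => measure_mono (Set.Ioi_subset_Ioi h)
  have hm (μ ν : Measure ℝ) [IsProbabilityMeasure μ] [IsProbabilityMeasure ν] : Measurable fun t =>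
      μ (Set.Iic t) * ν (Set.Ioi t) + μ (Set.Ioi t) * ν (Set.Iic t) :=
    ((hmI μ).mul (hmO ν)).add ((hmO μ).mul (hmI ν))
  rw [← lintegral_add_left (hm μ μ), ← lintegral_const_mul _ (hm μ ν)]
  refine lintegral_mono fun t => ?_
  have h1 (μ : Measure ℝ) [IsProbabilityMeasure μ] :
      ∃ u : ℝ, 0 ≤ u ∧ u ≤ 1 ∧ μ (Set.Iic t) = ENNReal.ofReal u ∧
        μ (Set.Ioi t) = ENNReal.ofReal (1 - u) := by
    refine ⟨μ.real (Set.Iic t), measureReal_nonneg, measureReal_le_one, ?_, ?_⟩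
    · simp
    · rw [← Set.compl_Iic, ← probReal_compl_eq_one_sub measurableSet_Iic]; simp
  obtain ⟨u, hu0, hu1, e1, e2⟩ := h1 μ
  obtain ⟨v, hv0, hv1, e3, e4⟩ := h1 ν
  have hu1' : 0 ≤ 1 - u := by linarith
  have hv1' : 0 ≤ 1 - v := by linarith
  simp only [e1, e2, e3, e4]
  rw [show (2 : ℝ≥0∞) = ENNReal.ofReal 2 by simp]
  simp only [← ENNReal.ofReal_mul, hu0, hv0, hu1', hv1']
  rw [← ENNReal.ofReal_add (by positivity) (by positivity),
    ← ENNReal.ofReal_add (by positivity) (by positivity),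
    ← ENNReal.ofReal_add (by positivity) (by positivity),
    ← ENNReal.ofReal_add (by positivity) (by positivity),
    ← ENNReal.ofReal_mul (by norm_num)]
  apply ENNReal.ofReal_le_ofReal
  nlinarith [sq_nonneg (u - v)]

/-- For fixed `b`, `b'`, the energy inequality for the laws of `g (b, ·)` and `g (b', ·)` reads `H
(b, b) + H (b', b') ≤ 2 H (b, b')`; averaging over independent `b`, `b'` gives the claim, with no
loss of a constant. -/
theorem lintegral_abs_sub_le_of_common {Ω₁ Ω₂ : Type*} [MeasurableSpace Ω₁] [MeasurableSpace Ω₂]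
    (μ₁ : Measure Ω₁) (μ₂ : Measure Ω₂) [IsProbabilityMeasure μ₁] [IsProbabilityMeasure μ₂]
    {g : Ω₁ × Ω₂ → ℝ} (hg : Measurable g) :
    ∫⁻ b, ∫⁻ c, ∫⁻ c', ENNReal.ofReal |g (b, c) - g (b, c')| ∂μ₂ ∂μ₂ ∂μ₁ ≤
      ∫⁻ b, ∫⁻ b', ∫⁻ c, ∫⁻ c', ENNReal.ofReal |g (b, c) - g (b', c')| ∂μ₂ ∂μ₂ ∂μ₁ ∂μ₁ := by
  have hsec (b : Ω₁) : Measurable fun c => g (b, c) := hg.comp measurable_prodMk_left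
  have hH : Measurable fun q : Ω₁ × Ω₁ =>
      ∫⁻ c, ∫⁻ c', ENNReal.ofReal |g (q.1, c) - g (q.2, c')| ∂μ₂ ∂μ₂ := by
    have : Measurable fun r : ((Ω₁ × Ω₁) × Ω₂) × Ω₂ =>
        ENNReal.ofReal |g (r.1.1.1, r.1.2) - g (r.1.1.2, r.2)| := by
      have a1 := hg.comp ((measurable_fst.fst.fst).prodMk measurable_fst.snd :
        Measurable fun r : ((Ω₁ × Ω₁) × Ω₂) × Ω₂ => (r.1.1.1, r.1.2))
      have a2 := hg.comp ((measurable_fst.fst.snd).prodMk measurable_snd :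
        Measurable fun r : ((Ω₁ × Ω₁) × Ω₂) × Ω₂ => (r.1.1.2, r.2))
      exact (measurable_norm.comp (a1.sub a2)).ennreal_ofReal
    exact this.lintegral_prod_right'.lintegral_prod_right'
  set H : Ω₁ × Ω₁ → ℝ≥0∞ := fun q =>
      ∫⁻ c, ∫⁻ c', ENNReal.ofReal |g (q.1, c) - g (q.2, c')| ∂μ₂ ∂μ₂ with hHdef
  have hdiag : Measurable fun b => H (b, b) := hH.comp (measurable_id.prodMk measurable_id)
  have hpt : ∀ b b', H (b, b) + H (b', b') ≤ 2 * H (b, b') := by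
    intro b b'
    have hlaw : ∀ b b', H (b, b') =
        ∫⁻ x, ∫⁻ y, ENNReal.ofReal |x - y| ∂(μ₂.map fun c => g (b', c))
          ∂(μ₂.map fun c => g (b, c)) := by
      intro b b'
      have habs : Measurable fun q : ℝ × ℝ => ENNReal.ofReal |q.1 - q.2| := by fun_prop
      have := Measure.isProbabilityMeasure_map (μ := μ₂) (hsec b').aemeasurable
      rw [lintegral_map habs.lintegral_prod_right' (hsec b)]
      refine lintegral_congr fun c => ?_
      exact (lintegral_map (habs.comp measurable_prodMk_left) (hsec b')).symm
    have := Measure.isProbabilityMeasure_map (μ := μ₂) (hsec b).aemeasurable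
    have := Measure.isProbabilityMeasure_map (μ := μ₂) (hsec b').aemeasurable
    rw [hlaw, hlaw, hlaw]
    exact energy_le _ _
  have h2 : 2 * ∫⁻ b, H (b, b) ∂μ₁ ≤ 2 * ∫⁻ b, ∫⁻ b', H (b, b') ∂μ₁ ∂μ₁ := by
    calc 2 * ∫⁻ b, H (b, b) ∂μ₁
        = ∫⁻ b, ∫⁻ b', (H (b, b) + H (b', b')) ∂μ₁ ∂μ₁ := by
          simp_rw [lintegral_add_right _ hdiag]
          rw [lintegral_add_right _ measurable_const]
          simp [two_mul]
      _ ≤ ∫⁻ b, ∫⁻ b', 2 * H (b, b') ∂μ₁ ∂μ₁ :=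
          lintegral_mono fun b => lintegral_mono fun b' => hpt b b'
      _ = 2 * ∫⁻ b, ∫⁻ b', H (b, b') ∂μ₁ ∂μ₁ := by
          rw [← lintegral_const_mul _ hH.lintegral_prod_right']
          exact lintegral_congr fun b =>
            lintegral_const_mul _ (hH.comp measurable_prodMk_left)
  exact (ENNReal.mul_le_mul_iff_right (by norm_num) (by norm_num)).1 h2

end Energy

/-! ### Monotonicity and subadditivity of the swap distance -/

section SwapMonotone

variable {Z : Type*} [MeasurableSpace Z] {P : Measure Z} [IsProbabilityMeasure P]

theorem measurable_sumElim {ι κ : Type*} {Ω : Type*} [MeasurableSpace Ω] {a : Ω → ι → Z}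
    {b : Ω → κ → Z} (ha : Measurable a) (hb : Measurable b) :
    Measurable fun ω => Sum.elim (a ω) (b ω) := by
  refine measurable_pi_lambda _ fun j => ?_
  rcases j with j | j
  · exact (measurable_pi_apply j).comp ha
  · exact (measurable_pi_apply j).comp hb

theorem lintegral_sum_index {ι κ : Type*} [Fintype ι] [Fintype κ] {F : (ι ⊕ κ → Z) → ℝ≥0∞}
    (hF : Measurable F) :
    ∫⁻ D, F D ∂(Measure.pi fun _ => P) =
      ∫⁻ a : ι → Z, ∫⁻ b : κ → Z, F (Sum.elim a b) ∂(Measure.pi fun _ => P)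
        ∂(Measure.pi fun _ => P) := by
  have hm : Measurable fun q : (ι → Z) × (κ → Z) => F (Sum.elim q.1 q.2) :=
    hF.comp (measurable_sumElim measurable_fst measurable_snd)
  rw [← lintegral_prod _ hm.aemeasurable,
    ← (measurePreserving_sumPiEquivProdPi (fun _ : ι ⊕ κ => P)).lintegral_comp hm]
  refine lintegral_congr fun D => ?_
  congr 1
  funext j
  rcases j with j | j <;> rfl

theorem lintegral_sum_index₃ {ι₁ ι₂ ι₃ : Type*} [Fintype ι₁] [Fintype ι₂] [Fintype ι₃]
    {F : (ι₁ ⊕ (ι₂ ⊕ ι₃) → Z) → ℝ≥0∞} (hF : Measurable F) :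
    ∫⁻ D, F D ∂(Measure.pi fun _ => P) =
      ∫⁻ a : ι₁ → Z, ∫⁻ b : ι₂ → Z, ∫⁻ c : ι₃ → Z, F (Sum.elim a (Sum.elim b c))
        ∂(Measure.pi fun _ => P) ∂(Measure.pi fun _ => P) ∂(Measure.pi fun _ => P) :=
  (lintegral_sum_index hF).trans (lintegral_congr fun _ => lintegral_sum_index
    (hF.comp (measurable_sumElim measurable_const measurable_id)))

theorem lintegral_sum_index₅ {ι₁ ι₂ ι₃ ι₄ ι₅ : Type*} [Fintype ι₁] [Fintype ι₂] [Fintype ι₃]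
    [Fintype ι₄] [Fintype ι₅] {F : (ι₁ ⊕ (ι₂ ⊕ (ι₃ ⊕ (ι₄ ⊕ ι₅))) → Z) → ℝ≥0∞}
    (hF : Measurable F) :
    ∫⁻ D, F D ∂(Measure.pi fun _ => P) =
      ∫⁻ a : ι₁ → Z, ∫⁻ b : ι₂ → Z, ∫⁻ c : ι₃ → Z, ∫⁻ d : ι₄ → Z, ∫⁻ e : ι₅ → Z,
        F (Sum.elim a (Sum.elim b (Sum.elim c (Sum.elim d e))))
        ∂(Measure.pi fun _ => P) ∂(Measure.pi fun _ => P) ∂(Measure.pi fun _ => P)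
        ∂(Measure.pi fun _ => P) ∂(Measure.pi fun _ => P) :=
  (lintegral_sum_index₃ hF).trans (lintegral_congr fun _ => lintegral_congr fun _ =>
    lintegral_sum_index₃ (hF.comp (measurable_sumElim measurable_const
      (measurable_sumElim measurable_const measurable_id))))

theorem lintegral_sum_index₆ {ι₁ ι₂ ι₃ ι₄ ι₅ ι₆ : Type*} [Fintype ι₁] [Fintype ι₂] [Fintype ι₃]
    [Fintype ι₄] [Fintype ι₅] [Fintype ι₆]
    {F : (ι₁ ⊕ (ι₂ ⊕ (ι₃ ⊕ (ι₄ ⊕ (ι₅ ⊕ ι₆)))) → Z) → ℝ≥0∞} (hF : Measurable F) :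
    ∫⁻ D, F D ∂(Measure.pi fun _ => P) =
      ∫⁻ a : ι₁ → Z, ∫⁻ b : ι₂ → Z, ∫⁻ c : ι₃ → Z, ∫⁻ d : ι₄ → Z, ∫⁻ e : ι₅ → Z, ∫⁻ g : ι₆ → Z,
        F (Sum.elim a (Sum.elim b (Sum.elim c (Sum.elim d (Sum.elim e g)))))
        ∂(Measure.pi fun _ => P) ∂(Measure.pi fun _ => P) ∂(Measure.pi fun _ => P)
        ∂(Measure.pi fun _ => P) ∂(Measure.pi fun _ => P) ∂(Measure.pi fun _ => P) :=
  (lintegral_sum_index hF).trans (lintegral_congr fun _ => lintegral_sum_index₅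
    (hF.comp (measurable_sumElim measurable_const measurable_id)))

theorem measurable_abs_fit_sub {p : ℕ} {f : (Fin p → Z) → Z → ℝ}
    (hf : Measurable fun q : (Fin p → Z) × Z => f q.1 q.2) {Ω : Type*} [MeasurableSpace Ω]
    {a b : Ω → Fin p → Z} {z : Ω → Z} (ha : Measurable a) (hb : Measurable b)
    (hz : Measurable z) :
    Measurable fun ω => ENNReal.ofReal |f (a ω) (z ω) - f (b ω) (z ω)| :=
  (measurable_norm.comp ((hf.comp (ha.prodMk hz)).sub (hf.comp (hb.prodMk hz)))).ennreal_ofReal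

theorem measurable_comp_index {ι κ : Type*} (u : κ → ι) :
    Measurable fun D : ι → Z => D ∘ u :=
  measurable_pi_lambda _ fun j => measurable_pi_apply (u j)

/-- With the test point and the points outside `t` held fixed, let `b` be the points in `t \ s` and
`c` those in `s`. The left side redraws `c` with `b` shared, the right side redraws both, so
`lintegral_abs_sub_le_of_common` applies conditionally. -/
theorem swapDist_mono {p : ℕ} {f : (Fin p → Z) → Z → ℝ}
    (hf : Measurable fun q : (Fin p → Z) × Z => f q.1 q.2) {s t : Finset (Fin p)} (hst : s ⊆ t) :
    swapDist P f s ≤ swapDist P f t := by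
  -- Index blocks: `a` for the points outside `t`, `Unit` for the test point, `b` for `t \ s`, and
  -- `c`, `d` for two draws of the points in `s`. The second pool has one more block `b₂'`, a fresh
  -- draw for `t \ s`.
  let a₁ : Fin p → Fin p ⊕ (Unit ⊕ (Fin p ⊕ (Fin p ⊕ Fin p))) := Sum.inl
  let b₁ : Fin p → Fin p ⊕ (Unit ⊕ (Fin p ⊕ (Fin p ⊕ Fin p))) := fun j =>
    Sum.inr (Sum.inr (Sum.inl j))
  let c₁ : Fin p → Fin p ⊕ (Unit ⊕ (Fin p ⊕ (Fin p ⊕ Fin p))) := fun j =>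
    Sum.inr (Sum.inr (Sum.inr (Sum.inl j)))
  let d₁ : Fin p → Fin p ⊕ (Unit ⊕ (Fin p ⊕ (Fin p ⊕ Fin p))) := fun j =>
    Sum.inr (Sum.inr (Sum.inr (Sum.inr j)))
  let a₂ : Fin p → Fin p ⊕ (Unit ⊕ (Fin p ⊕ (Fin p ⊕ (Fin p ⊕ Fin p)))) := Sum.inl
  let b₂ : Fin p → Fin p ⊕ (Unit ⊕ (Fin p ⊕ (Fin p ⊕ (Fin p ⊕ Fin p)))) := fun j =>
    Sum.inr (Sum.inr (Sum.inl j))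
  let b₂' : Fin p → Fin p ⊕ (Unit ⊕ (Fin p ⊕ (Fin p ⊕ (Fin p ⊕ Fin p)))) := fun j =>
    Sum.inr (Sum.inr (Sum.inr (Sum.inl j)))
  let c₂ : Fin p → Fin p ⊕ (Unit ⊕ (Fin p ⊕ (Fin p ⊕ (Fin p ⊕ Fin p)))) := fun j =>
    Sum.inr (Sum.inr (Sum.inr (Sum.inr (Sum.inl j))))
  let d₂ : Fin p → Fin p ⊕ (Unit ⊕ (Fin p ⊕ (Fin p ⊕ (Fin p ⊕ Fin p)))) := fun j =>
    Sum.inr (Sum.inr (Sum.inr (Sum.inr (Sum.inr j))))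
  have e₁ := lintegral_pair_eq_swapDist (P := P) hf (s := s) (e := mixOn s (mixOn t a₁ b₁) c₁)
    (e' := mixOn s (mixOn t a₁ b₁) d₁) (i := Sum.inr (Sum.inl ()))
    (by intro j k h; simp only [mixOn, a₁, b₁, c₁] at h; grind)
    (by intro j k h; simp only [mixOn, a₁, b₁, d₁] at h; grind)
    (by intro j h; simp only [mixOn, a₁, b₁, c₁] at h; grind)
    (by intro j h; simp only [mixOn, a₁, b₁, d₁] at h; grind)
    (by intro j h; simp [mixOn, h])
    (by intro j hj k h; simp only [mixOn, a₁, b₁, c₁, d₁] at h; grind)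
  have e₂ := lintegral_pair_eq_swapDist (P := P) hf (s := t) (e := mixOn s (mixOn t a₂ b₂) c₂)
    (e' := mixOn s (mixOn t a₂ b₂') d₂) (i := Sum.inr (Sum.inl ()))
    (by intro j k h; simp only [mixOn, a₂, b₂, c₂] at h; grind)
    (by intro j k h; simp only [mixOn, a₂, b₂', d₂] at h; grind)
    (by intro j h; simp only [mixOn, a₂, b₂, c₂] at h; grind)
    (by intro j h; simp only [mixOn, a₂, b₂', d₂] at h; grind)
    (by intro j h; have : j ∉ s := fun h' => h (hst h'); simp [mixOn, h, this, a₂])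
    (by intro j hj k h; simp only [mixOn, a₂, b₂, c₂, b₂', d₂] at h; grind)
  rw [← e₁, ← e₂]
  have elim_mix : ∀ {ι : Type} (D : ι → Z) (s : Finset (Fin p)) (u v : Fin p → ι),
      D ∘ mixOn s u v = mixOn s (D ∘ u) (D ∘ v) := by
    intro ι D s u v
    funext j
    simp only [mixOn, Function.comp_apply]
    split_ifs <;> rfl
  rw [lintegral_sum_index₅ (measurable_abs_fit_sub hf (measurable_comp_index _)
      (measurable_comp_index _) (measurable_pi_apply _)),
    lintegral_sum_index₆ (measurable_abs_fit_sub hf (measurable_comp_index _)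
      (measurable_comp_index _) (measurable_pi_apply _))]
  refine lintegral_mono fun a => lintegral_mono fun z => ?_
  have hg : Measurable fun q : (Fin p → Z) × (Fin p → Z) =>
      f (mixOn s (mixOn t a q.1) q.2) (z ()) :=
    hf.comp ((measurable_mixOn s (measurable_mixOn t measurable_const measurable_fst)
      measurable_snd).prodMk measurable_const)
  have key := lintegral_abs_sub_le_of_common (Measure.pi fun _ : Fin p => P)
    (Measure.pi fun _ : Fin p => P) hg
  simp only [elim_mix]
  exact key

/-- Permuting both samples simultaneously leaves `f` unchanged and moves the swapped positions, so
only the cardinality of `s` matters. -/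
theorem swapDist_image_perm {p : ℕ} {f : (Fin p → Z) → Z → ℝ}
    (hf : Measurable fun q : (Fin p → Z) × Z => f q.1 q.2)
    (hsymm : ∀ (π : Equiv.Perm (Fin p)) (D : Fin p → Z), f (D ∘ π) = f D) (s : Finset (Fin p))
    (π : Equiv.Perm (Fin p)) : swapDist P f (s.map π.toEmbedding) = swapDist P f s := by
  let e : Fin p → Fin p ⊕ (Fin p ⊕ Unit) := Sum.inl
  let e' : Fin p → Fin p ⊕ (Fin p ⊕ Unit) := mixOn (s.map π.toEmbedding) Sum.inl fun j =>
    Sum.inr (Sum.inl j)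
  have h1 := lintegral_pair_eq_swapDist (P := P) hf (s := s.map π.toEmbedding) (e := e)
    (e' := e') (i := Sum.inr (Sum.inr ()))
    (by intro j k h; simpa [e] using h)
    (by intro j k h; simp only [mixOn, e'] at h; grind)
    (by intro j h; simp [e] at h)
    (by intro j h; simp only [mixOn, e'] at h; grind)
    (by intro j h; simp only [mixOn, e', e]; grind)
    (by intro j hj k h; simp only [mixOn, e', e] at h; grind)
  have h2 := lintegral_pair_eq_swapDist (P := P) hf (s := s) (e := e ∘ π)
    (e' := e' ∘ π) (i := Sum.inr (Sum.inr ()))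
    (by intro j k h; simpa [e] using h)
    (by intro j k h; simp only [mixOn, e', Function.comp_apply] at h; apply π.injective; grind)
    (by intro j h; simp [e] at h)
    (by intro j h; simp only [mixOn, e', Function.comp_apply] at h; grind)
    (by intro j h; simp [mixOn, e', e, h])
    (by intro j hj k h; simp [mixOn, e', e, hj] at h)
  rw [← h1, ← h2]
  simp only [← Function.comp_assoc, hsymm]

theorem exists_perm_map_eq {α : Type*} [Fintype α] [DecidableEq α] {s t : Finset α}
    (h : s.card = t.card) : ∃ π : Equiv.Perm α, s.map π.toEmbedding = t := by
  let e : {x // x ∈ s} ≃ {x // x ∈ t} := Fintype.equivOfCardEq (by simpa using h)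
  refine ⟨e.extendSubtype, Finset.eq_of_subset_of_card_le ?_ (by simp [h])⟩
  intro y hy
  obtain ⟨x, hx, rfl⟩ := Finset.mem_map.1 hy
  exact e.extendSubtype_mem x hx

theorem swapDist_le_of_card_le {p : ℕ} {f : (Fin p → Z) → Z → ℝ}
    (hf : Measurable fun q : (Fin p → Z) × Z => f q.1 q.2)
    (hsymm : ∀ (π : Equiv.Perm (Fin p)) (D : Fin p → Z), f (D ∘ π) = f D)
    {s t : Finset (Fin p)} (h : s.card ≤ t.card) : swapDist P f s ≤ swapDist P f t := by
  obtain ⟨s', hs', hc⟩ := Finset.exists_subset_card_eq h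
  obtain ⟨π, hπ⟩ := exists_perm_map_eq hc.symm
  rw [← swapDist_image_perm hf hsymm s π, hπ]
  exact swapDist_mono hf hs'

/-- Models fitted to two samples differing in at most `#t` points are, on average, at most
`swapDist P f t` apart. -/
theorem lintegral_pair_le_swapDist {p : ℕ} {f : (Fin p → Z) → Z → ℝ}
    (hf : Measurable fun q : (Fin p → Z) × Z => f q.1 q.2)
    (hsymm : ∀ (π : Equiv.Perm (Fin p)) (D : Fin p → Z), f (D ∘ π) = f D)
    {t : Finset (Fin p)} {ι : Type*} [Fintype ι] [DecidableEq ι] {e e' : Fin p → ι} {i : ι}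
    (he : Function.Injective e) (he' : Function.Injective e') (hei : ∀ j, e j ≠ i)
    (hei' : ∀ j, e' j ≠ i)
    (ht : (Finset.univ.filter fun j => e' j ∉ Finset.univ.image e).card ≤ t.card) :
    ∫⁻ D : ι → Z, ENNReal.ofReal |f (D ∘ e) (D i) - f (D ∘ e') (D i)| ∂(Measure.pi fun _ => P) ≤
      swapDist P f t := by
  classical
  have hex : ∀ j : {j // e' j ∈ Finset.univ.image e}, ∃ k, e k = e' j := by
    intro j
    simpa using j.2
  choose r hr using hex
  have hrinj : Function.Injective r := by
    intro a b h
    have := (hr a).symm.trans ((congrArg e h).trans (hr b))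
    exact Subtype.ext (he' this)
  -- The shared points are matched to their positions in `e`, and the matching is extended to a
  -- permutation `π`. By symmetry `e` may be replaced by `e ∘ π`, which agrees with `e'` wherever a
  -- point is shared.
  let q : {j // e' j ∈ Finset.univ.image e} ≃ {j // j ∈ Set.range r} := Equiv.ofInjective r hrinj
  let π : Equiv.Perm (Fin p) := q.extendSubtype
  have hπ : ∀ j, e' j ∈ Finset.univ.image e → e (π j) = e' j := by
    intro j hj
    have : π j = r ⟨j, hj⟩ := q.extendSubtype_apply_of_mem j hj
    rw [this, hr]
  have h1 := lintegral_pair_eq_swapDist (P := P) hf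
    (s := Finset.univ.filter fun j => e' j ∉ Finset.univ.image e) (e := e ∘ π) (e' := e') (i := i)
    (he.comp π.injective) he' (fun j => hei _) hei'
    (by
      intro j hj
      simp only [Finset.mem_filter, Finset.mem_univ, true_and, not_not] at hj
      exact (hπ j hj).symm)
    (by
      intro j hj k h
      rw [Finset.mem_filter] at hj
      exact hj.2 (Finset.mem_image.2 ⟨π k, Finset.mem_univ _, h⟩))
  simp only [← Function.comp_assoc, hsymm] at h1
  rw [h1]
  exact swapDist_le_of_card_le hf hsymm ht

/-- Triangle inequality through the sample in which only `s` has been swapped; it differs from the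
final sample at the single position `x`. -/
theorem swapDist_insert_le {p : ℕ} {f : (Fin p → Z) → Z → ℝ}
    (hf : Measurable fun q : (Fin p → Z) × Z => f q.1 q.2) {s : Finset (Fin p)} {x : Fin p}
    (hx : x ∉ s) : swapDist P f (insert x s) ≤ swapDist P f s + swapDist P f {x} := by
  let e : Fin p → Fin p ⊕ (Fin p ⊕ Unit) := Sum.inl
  let e' : Finset (Fin p) → Fin p → Fin p ⊕ (Fin p ⊕ Unit) := fun s => mixOn s Sum.inl fun j =>
    Sum.inr (Sum.inl j)
  have h1 (s : Finset (Fin p)) := lintegral_pair_eq_swapDist (P := P) hf (s := s) (e := e)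
    (e' := e' s) (i := Sum.inr (Sum.inr ()))
    (by intro j k h; simpa [e] using h)
    (by intro j k h; simp only [mixOn, e'] at h; grind)
    (by intro j h; simp [e] at h)
    (by intro j h; simp only [mixOn, e'] at h; grind)
    (by intro j h; simp only [mixOn, e', e]; grind)
    (by intro j hj k h; simp only [mixOn, e', e] at h; grind)
  have h2 := lintegral_pair_eq_swapDist (P := P) hf (s := {x}) (e := e' s)
    (e' := e' (insert x s)) (i := Sum.inr (Sum.inr ()))
    (by intro j k h; simp only [mixOn, e'] at h; grind)
    (by intro j k h; simp only [mixOn, e'] at h; grind)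
    (by intro j h; simp only [mixOn, e'] at h; grind)
    (by intro j h; simp only [mixOn, e'] at h; grind)
    (by intro j h; simp only [mixOn, e']; grind)
    (by intro j hj k h; simp only [mixOn, e'] at h; grind)
  rw [← h1, ← h1, ← h2, ← lintegral_add_left (measurable_abs_fit_sub hf (measurable_comp_index _)
      (measurable_comp_index _) (measurable_pi_apply _))]
  refine lintegral_mono fun D => ?_
  rw [← ENNReal.ofReal_add (abs_nonneg _) (abs_nonneg _)]
  exact ENNReal.ofReal_le_ofReal (abs_sub_le _ _ _)

theorem swapDist_empty {p : ℕ} (f : (Fin p → Z) → Z → ℝ) : swapDist P f ∅ = 0 := by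
  have h : ∀ D D' : Fin p → Z, mixOn ∅ D D' = D := fun D D' => by funext j; simp [mixOn]
  simp [swapDist, h]

theorem swapDist_le_card_mul {p : ℕ} {f : (Fin p → Z) → Z → ℝ}
    (hf : Measurable fun q : (Fin p → Z) × Z => f q.1 q.2)
    (hsymm : ∀ (π : Equiv.Perm (Fin p)) (D : Fin p → Z), f (D ∘ π) = f D)
    (s : Finset (Fin p)) {t : Finset (Fin p)} (ht : t.card = 1) :
    swapDist P f s ≤ s.card * swapDist P f t := by
  induction s using Finset.induction_on with
  | empty => simp [swapDist_empty]
  | insert x s hx ih =>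
    rw [Finset.card_insert_of_notMem hx, Nat.cast_add, Nat.cast_one, add_mul, one_mul]
    refine (swapDist_insert_le hf hx).trans (add_le_add ih ?_)
    exact swapDist_le_of_card_le hf hsymm (by simp [ht])

end SwapMonotone

/-! ### Swap-stability of an algorithm as a swap distance -/

section SwapStability

variable {𝒳 : Type*} [MeasurableSpace 𝒳]

theorem RegressionAlgorithm.measurable_fit_fst (A : RegressionAlgorithm 𝒳) (p : ℕ) :
    Measurable fun q : (Fin p → 𝒳 × ℝ) × (𝒳 × ℝ) => A.fit p q.1 q.2.1 :=
  (A.measurable_fit p).comp (measurable_fst.prodMk measurable_snd.fst)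

theorem RegressionAlgorithm.fit_comp_perm (A : RegressionAlgorithm 𝒳) {p : ℕ}
    (π : Equiv.Perm (Fin p)) (D : Fin p → 𝒳 × ℝ) : A.fit p (D ∘ π) = A.fit p D :=
  A.symmetric p π D

theorem swapStability_eq_swapDist (A : RegressionAlgorithm 𝒳) (P : Measure (𝒳 × ℝ)) (m p : ℕ) :
    swapStability A P m p = swapDist P (fun D z => A.fit p D z.1)
      (Finset.univ.filter fun j : Fin p => p - m ≤ (j : ℕ)) := by
  have : ∀ D D' : Fin p → 𝒳 × ℝ, swapLast m D D' =
      mixOn (Finset.univ.filter fun j : Fin p => p - m ≤ (j : ℕ)) D D' := by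
    intro D D'
    funext j
    simp only [swapLast, mixOn, Finset.mem_filter, Finset.mem_univ, true_and]
    split_ifs <;> first | rfl | omega
  simp only [swapStability, swapDist, this]
  rfl

theorem card_filter_last {m p : ℕ} (h : m ≤ p) :
    (Finset.univ.filter fun j : Fin p => p - m ≤ (j : ℕ)).card = m := by
  have h1 : (Finset.univ.filter fun j : Fin p => ¬ (j : ℕ) < p - m).card = m := by
    rw [Finset.filter_not, Finset.card_sdiff_of_subset (Finset.filter_subset _ _),
      Fin.card_filter_val_lt]
    simp only [Finset.card_univ, Fintype.card_fin]
    omega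
  simpa only [not_lt] using h1

theorem swapStability_le_mul (A : RegressionAlgorithm 𝒳) (P : Measure (𝒳 × ℝ))
    [IsProbabilityMeasure P] {m p : ℕ} (h : m ≤ p) (hp : 1 ≤ p) :
    swapStability A P m p ≤ m * swapStability A P 1 p := by
  rw [swapStability_eq_swapDist, swapStability_eq_swapDist]
  have := swapDist_le_card_mul (P := P) (f := fun D z => A.fit p D z.1) (A.measurable_fit_fst p)
    (fun π D => by rw [A.fit_comp_perm])
    (Finset.univ.filter fun j : Fin p => p - m ≤ (j : ℕ)) (card_filter_last hp)
  rwa [card_filter_last h] at this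

end SwapStability

/-! ### Hoeffding inequalities with and without replacement -/

section Hoeffding

/-- Hoeffding's lemma for a Bernoulli variable: its range has length `1`, hence variance proxy
`1/4`; the factor `exp (t p)` undoes the centring. -/
theorem bernoulli_mgf_le {p : ℝ} (h0 : 0 ≤ p) (h1 : p ≤ 1) (t : ℝ) :
    1 + p * (Real.exp t - 1) ≤ Real.exp (t * p + t ^ 2 / 8) := by
  let μ : Measure ℝ :=
    ENNReal.ofReal p • Measure.dirac 1 + ENNReal.ofReal (1 - p) • Measure.dirac 0
  have h1' : 0 ≤ 1 - p := by linarith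
  have : IsProbabilityMeasure μ := ⟨by
    simp only [μ, Measure.coe_add, Measure.coe_smul, Pi.add_apply, Pi.smul_apply, measure_univ,
      smul_eq_mul, mul_one]
    rw [← ENNReal.ofReal_add h0 h1']; simp⟩
  have hint (f : ℝ → ℝ) : ∫ x, f x ∂μ = p * f 1 + (1 - p) * f 0 := by
    have hi (c : ℝ) (x : ℝ) : Integrable f (ENNReal.ofReal c • Measure.dirac x) :=
      (integrable_dirac (by simp)).smul_measure (by simp)
    rw [integral_add_measure (hi _ _) (hi _ _), integral_smul_measure, integral_smul_measure]
    simp [h0, h1]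
  have hs := ProbabilityTheory.hasSubgaussianMGF_of_mem_Icc (μ := μ) (X := fun x : ℝ => x)
    (a := 0) (b := 1) aemeasurable_id (by
      simp only [μ]
      rw [ae_add_measure_iff]
      constructor
      · exact Measure.ae_smul_measure (by simp [ae_dirac_eq]) _
      · exact Measure.ae_smul_measure (by simp [ae_dirac_eq]) _)
  have hm := hs.mgf_le t
  rw [ProbabilityTheory.mgf, hint, hint] at hm
  have e1 : t * p + t ^ 2 / 8 = t * p + ((‖(1:ℝ) - 0‖₊ / 2) ^ 2 : NNReal) * t ^ 2 / 2 := by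
    simp; ring
  rw [e1, Real.exp_add]
  have e2 : 1 + p * (Real.exp t - 1) = Real.exp (t * p) *
      (p * Real.exp (t * (1 - (p * 1 + (1 - p) * 0))) +
        (1 - p) * Real.exp (t * (0 - (p * 1 + (1 - p) * 0)))) := by
    rw [mul_add, mul_left_comm, ← Real.exp_add, mul_left_comm, ← Real.exp_add]
    ring_nf
    simp
    ring
  rw [e2]
  exact mul_le_mul_of_nonneg_left hm (Real.exp_pos _).le

variable {ι : Type*} [Fintype ι] [DecidableEq ι]

/-- The probability that a uniformly random permutation maps `T` into `C` is at most what it would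
be for sampling with replacement. -/
theorem card_perm_mapsTo_le (C T : Finset ι) :
    ∑ σ : Equiv.Perm ι, ∏ i ∈ T, (if σ i ∈ C then (1 : ℝ) else 0) ≤
      (Fintype.card ι).factorial * ((C.card : ℝ) / Fintype.card ι) ^ T.card := by
  induction T using Finset.induction_on with
  | empty => simp [Fintype.card_perm]
  | insert j T hj ih =>
    set M : ℝ := ∑ σ : Equiv.Perm ι, ∏ i ∈ T, (if σ i ∈ C then (1 : ℝ) else 0) with hM
    set M' : ℝ := ∑ σ : Equiv.Perm ι, ∏ i ∈ insert j T, (if σ i ∈ C then (1 : ℝ) else 0) with hM'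
    have hM0 : 0 ≤ M := Finset.sum_nonneg fun σ _ => Finset.prod_nonneg fun i _ => by
      split_ifs <;> norm_num
    -- Precomposing with the transposition of `j` and `k` shows that all points outside `T` play the
    -- same role.
    have hswap : ∀ k ∈ Tᶜ, ∑ σ : Equiv.Perm ι,
        (∏ i ∈ T, (if σ i ∈ C then (1 : ℝ) else 0)) * (if σ k ∈ C then 1 else 0) = M' := by
      intro k hk
      rw [Finset.mem_compl] at hk
      rw [hM', ← Equiv.sum_comp (Equiv.mulRight (Equiv.swap j k))]
      refine Finset.sum_congr rfl fun σ _ => ?_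
      rw [Finset.prod_insert hj, mul_comm]
      congr 1
      · simp
      · refine Finset.prod_congr rfl fun i hi => ?_
        have h1 : i ≠ j := fun h => hj (h ▸ hi)
        have h2 : i ≠ k := fun h => hk (h ▸ hi)
        simp [Equiv.swap_apply_of_ne_of_ne h1 h2]
    -- Double count of the pairs `(σ, k)` with `k ∉ T` and `σ` mapping `T ∪ {k}` into `C`: a `σ`
    -- mapping `T` into `C` leaves `#C - #T` choices of `k`.
    have hsum : ((Fintype.card ι : ℝ) - T.card) * M' = ((C.card : ℝ) - T.card) * M := by
      have e1 : ∑ k ∈ Tᶜ, M' = ((Fintype.card ι : ℝ) - T.card) * M' := by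
        rw [Finset.sum_const, nsmul_eq_mul, Finset.card_compl, Nat.cast_sub (Finset.card_le_univ T)]
      rw [← e1, ← Finset.sum_congr rfl hswap, Finset.sum_comm, hM, Finset.mul_sum]
      refine Finset.sum_congr rfl fun σ _ => ?_
      rw [← Finset.mul_sum]
      by_cases hall : ∀ i ∈ T, σ i ∈ C
      · have e2 : ∑ k : ι, (if σ k ∈ C then (1 : ℝ) else 0) = C.card := by
          rw [Equiv.sum_comp σ fun k => if k ∈ C then (1 : ℝ) else 0]
          simp
        have e3 : ∑ k ∈ T, (if σ k ∈ C then (1 : ℝ) else 0) = T.card := by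
          rw [Finset.sum_congr rfl fun i hi => if_pos (hall i hi)]
          simp
        have e4 := Finset.sum_add_sum_compl T fun k => if σ k ∈ C then (1 : ℝ) else 0
        rw [mul_comm]
        congr 1
        linarith
      · push Not at hall
        obtain ⟨i, hi, hiC⟩ := hall
        have : ∏ i ∈ T, (if σ i ∈ C then (1 : ℝ) else 0) = 0 :=
          Finset.prod_eq_zero hi (by simp [hiC])
        rw [this]; simp
    have hcard : (T.card : ℝ) + 1 ≤ Fintype.card ι := by
      have := Finset.card_le_univ (insert j T)
      rw [Finset.card_insert_of_notMem hj] at this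
      exact_mod_cast this
    have hC : (C.card : ℝ) ≤ Fintype.card ι := by exact_mod_cast Finset.card_le_univ C
    have hpos : 0 < (Fintype.card ι : ℝ) - T.card := by linarith
    have hN : (0 : ℝ) < Fintype.card ι := by
      have : (0 : ℝ) ≤ T.card := by positivity
      linarith
    -- `(#C - #T) / (N - #T) ≤ #C / N` because `#C ≤ N`.
    have hstep : M' ≤ (C.card : ℝ) / Fintype.card ι * M := by
      have : M' = ((C.card : ℝ) - T.card) / ((Fintype.card ι : ℝ) - T.card) * M := by
        field_simp
        linarith
      rw [this]
      refine mul_le_mul_of_nonneg_right ?_ hM0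
      rw [div_le_div_iff₀ hpos hN]
      nlinarith [(Nat.cast_nonneg T.card : (0 : ℝ) ≤ T.card)]
    rw [Finset.card_insert_of_notMem hj, pow_succ]
    calc M' ≤ (C.card : ℝ) / Fintype.card ι * M := hstep
      _ ≤ (C.card : ℝ) / Fintype.card ι *
          ((Fintype.card ι).factorial * ((C.card : ℝ) / Fintype.card ι) ^ T.card) :=
        mul_le_mul_of_nonneg_left ih (by positivity)
      _ = _ := by ring

theorem exp_card_filter_eq_prod {κ : Type*} (B : Finset κ) (q : κ → Prop) [DecidablePred q]
    (t : ℝ) : Real.exp (t * (B.filter q).card) =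
      ∏ i ∈ B, (1 + (Real.exp t - 1) * (if q i then 1 else 0)) := by
  have : (t * (B.filter q).card : ℝ) = ∑ i ∈ B, t * (if q i then 1 else 0) := by
    rw [← Finset.mul_sum]
    simp
  rw [this, Real.exp_sum]
  refine Finset.prod_congr rfl fun i _ => ?_
  split_ifs <;> simp

/-- Hoeffding's inequality for sampling without replacement. -/
theorem card_perm_ge_le (C B : Finset ι) {ε : ℝ} (hε : 0 ≤ ε) :
    ((Finset.univ.filter fun σ : Equiv.Perm ι =>
      ((C.card : ℝ) / Fintype.card ι + ε) * B.card ≤ (B.filter fun i => σ i ∈ C).card).card : ℝ) ≤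
      (Fintype.card ι).factorial * Real.exp (-2 * B.card * ε ^ 2) := by
  set p : ℝ := (C.card : ℝ) / Fintype.card ι with hp
  have hp0 : 0 ≤ p := by positivity
  have hp1 : p ≤ 1 := div_le_one_of_le₀ (by exact_mod_cast Finset.card_le_univ C) (by positivity)
  -- The Chernoff parameter `t = 4ε` minimises `t²/8 - tε`, with value `-2ε²`.
  set x : ℝ := Real.exp (4 * ε) - 1 with hx
  have hx0 : 0 ≤ x := by
    have := Real.one_le_exp (show 0 ≤ 4 * ε by positivity)
    linarith
  -- Expanded over subsets `T` of `B`, the exponential has coefficients `x ^ #T ≥ 0`, so the bound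
  -- for each `T` transfers to the moment generating function and compares it with the binomial one.
  have hmgf : ∑ σ : Equiv.Perm ι, Real.exp (4 * ε * (B.filter fun i => σ i ∈ C).card) ≤
      (Fintype.card ι).factorial * (1 + p * x) ^ B.card := by
    calc ∑ σ : Equiv.Perm ι, Real.exp (4 * ε * (B.filter fun i => σ i ∈ C).card)
        = ∑ σ : Equiv.Perm ι, ∑ T ∈ B.powerset, ∏ i ∈ T, (x * (if σ i ∈ C then 1 else 0)) := by
          refine Finset.sum_congr rfl fun σ _ => ?_
          rw [exp_card_filter_eq_prod, Finset.prod_one_add]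
      _ = ∑ T ∈ B.powerset, x ^ T.card *
            ∑ σ : Equiv.Perm ι, ∏ i ∈ T, (if σ i ∈ C then (1 : ℝ) else 0) := by
          rw [Finset.sum_comm]
          refine Finset.sum_congr rfl fun T _ => ?_
          rw [Finset.mul_sum]
          refine Finset.sum_congr rfl fun σ _ => ?_
          rw [Finset.prod_mul_distrib, Finset.prod_const]
      _ ≤ ∑ T ∈ B.powerset, x ^ T.card * ((Fintype.card ι).factorial * p ^ T.card) :=
          Finset.sum_le_sum fun T _ =>
            mul_le_mul_of_nonneg_left (card_perm_mapsTo_le C T) (by positivity)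
      _ = (Fintype.card ι).factorial * (1 + p * x) ^ B.card := by
          rw [← Finset.prod_const, Finset.prod_one_add, Finset.mul_sum]
          refine Finset.sum_congr rfl fun T _ => ?_
          rw [Finset.prod_const, mul_pow]
          ring
  set S := Finset.univ.filter fun σ : Equiv.Perm ι =>
      (p + ε) * B.card ≤ (B.filter fun i => σ i ∈ C).card with hS
  have hmarkov : (S.card : ℝ) * Real.exp (4 * ε * ((p + ε) * B.card)) ≤
      ∑ σ : Equiv.Perm ι, Real.exp (4 * ε * (B.filter fun i => σ i ∈ C).card) := by
    rw [← nsmul_eq_mul, ← Finset.sum_const]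
    refine (Finset.sum_le_sum fun σ hσ => ?_).trans
      (Finset.sum_le_univ_sum_of_nonneg fun σ => (Real.exp_pos _).le)
    rw [hS, Finset.mem_filter] at hσ
    exact Real.exp_le_exp.2 (mul_le_mul_of_nonneg_left hσ.2 (by positivity))
  have hb : (1 + p * x) ^ B.card ≤ Real.exp (4 * ε * p + (4 * ε) ^ 2 / 8) ^ B.card :=
    pow_le_pow_left₀ (by positivity) (bernoulli_mgf_le hp0 hp1 _) _
  have h1 : (S.card : ℝ) * Real.exp (4 * ε * ((p + ε) * B.card)) ≤
      (Fintype.card ι).factorial * Real.exp (4 * ε * p + (4 * ε) ^ 2 / 8) ^ B.card :=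
    hmarkov.trans (hmgf.trans (mul_le_mul_of_nonneg_left hb (by positivity)))
  have h2 : Real.exp (4 * ε * p + (4 * ε) ^ 2 / 8) ^ B.card =
      Real.exp (-2 * B.card * ε ^ 2) * Real.exp (4 * ε * ((p + ε) * B.card)) := by
    rw [← Real.exp_nat_mul, ← Real.exp_add]
    congr 1
    ring
  rw [h2] at h1
  exact le_of_mul_le_mul_right (h1.trans_eq (mul_assoc _ _ _).symm) (Real.exp_pos _)

variable {Z : Type*} [MeasurableSpace Z] {P : Measure Z} [IsProbabilityMeasure P]

theorem measurable_card_filter {Ω κ : Type*} [MeasurableSpace Ω] (B : Finset κ) {q : Ω → κ → Prop}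
    [∀ ω, DecidablePred (q ω)] (hq : ∀ i, MeasurableSet {ω | q ω i}) :
    Measurable fun ω => ((B.filter (q ω)).card : ℝ) := by
  have : (fun ω => ((B.filter (q ω)).card : ℝ)) =
      fun ω => ∑ i ∈ B, {ω | q ω i}.indicator (1 : Ω → ℝ) ω := by
    funext ω
    simp [Set.indicator_apply]
  rw [this]
  exact Finset.measurable_sum _ fun i _ => measurable_one.indicator (hq i)

/-- Hoeffding's inequality for exchangeable events: the number of those indexed by `B` that occur is
compared to the total number of those that occur. -/
theorem measure_exchangeable_ge_le {c : (ι → Z) → Finset ι}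
    (hc : ∀ i, MeasurableSet {D | i ∈ c D})
    (hequiv : ∀ (σ : Equiv.Perm ι) (D : ι → Z) (i : ι), i ∈ c (D ∘ σ) ↔ σ i ∈ c D)
    (B : Finset ι) {ε : ℝ} (hε : 0 ≤ ε) :
    (Measure.pi fun _ => P) {D : ι → Z | (((c D).card : ℝ) / Fintype.card ι + ε) * B.card ≤
      (B.filter fun i => i ∈ c D).card} ≤ ENNReal.ofReal (Real.exp (-2 * B.card * ε ^ 2)) := by
  set S := {D : ι → Z | (((c D).card : ℝ) / Fintype.card ι + ε) * B.card ≤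
      (B.filter fun i => i ∈ c D).card} with hS
  have hcard : ∀ D, ((c D).card : ℝ) = ((Finset.univ.filter fun i => i ∈ c D).card : ℝ) := by
    intro D; simp
  have hSm : MeasurableSet S := by
    have h1 : Measurable fun D => ((c D).card : ℝ) := by
      simp_rw [hcard]
      exact measurable_card_filter _ hc
    exact measurableSet_le (((h1.div_const _).add_const _).mul_const _)
      (measurable_card_filter _ hc)
  have hmp (σ : Equiv.Perm ι) := measurePreserving_comp_injective P σ.injective
  have h1 : ∀ σ : Equiv.Perm ι, ∫⁻ D, S.indicator 1 (D ∘ σ) ∂(Measure.pi fun _ => P) =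
      (Measure.pi fun _ => P) S := by
    intro σ
    rw [(hmp σ).lintegral_comp (measurable_one.indicator hSm), lintegral_indicator_one hSm]
  -- The law of the pool is permutation invariant, so the probability may be averaged over all `σ`.
  -- For each fixed `D`, this average is the permutation bound for the fixed set `c D`.
  have h2 : ((Fintype.card ι).factorial : ℝ≥0∞) * (Measure.pi fun _ => P) S ≤
      (Fintype.card ι).factorial * ENNReal.ofReal (Real.exp (-2 * B.card * ε ^ 2)) := by
    calc ((Fintype.card ι).factorial : ℝ≥0∞) * (Measure.pi fun _ => P) S
        = ∑ σ : Equiv.Perm ι, ∫⁻ D, S.indicator 1 (D ∘ σ) ∂(Measure.pi fun _ => P) := by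
          simp [h1, Fintype.card_perm]
      _ = ∫⁻ D, ∑ σ : Equiv.Perm ι, S.indicator 1 (D ∘ σ) ∂(Measure.pi fun _ => P) := by
          rw [lintegral_finsetSum]
          exact fun σ _ => (measurable_one.indicator hSm).comp (hmp σ).measurable
      _ ≤ ∫⁻ _ : ι → Z, ENNReal.ofReal ((Fintype.card ι).factorial *
            Real.exp (-2 * B.card * ε ^ 2)) ∂(Measure.pi fun _ => P) := by
          refine lintegral_mono fun D => ?_
          refine le_trans (le_of_eq ?_) (ENNReal.ofReal_le_ofReal (card_perm_ge_le (c D) B hε))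
          rw [ENNReal.ofReal_natCast, Finset.card_filter, Nat.cast_sum]
          refine Finset.sum_congr rfl fun σ _ => ?_
          have hcσ : (c (D ∘ σ)).card = (c D).card := by
            have : c (D ∘ σ) = (c D).map σ.symm.toEmbedding := by
              ext i
              rw [hequiv, Finset.mem_map_equiv]
              simp
            rw [this, Finset.card_map]
          simp only [Set.indicator_apply, hS, Set.mem_ofPred_eq, hcσ, hequiv, Pi.one_apply]
          split_ifs <;> simp
      _ = _ := by
          rw [lintegral_const, measure_univ, mul_one, ENNReal.ofReal_mul (by positivity),
            ENNReal.ofReal_natCast]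
  exact (ENNReal.mul_le_mul_iff_right (by exact_mod_cast (Nat.factorial_pos _).ne')
    (ENNReal.natCast_ne_top _)).1 h2

omit [DecidableEq ι] in
/-- Hoeffding's inequality for the number of points of an i.i.d. sample falling in a set. -/
theorem measure_iid_card_le_le {M : Set Z} [DecidablePred (· ∈ M)] (hM : MeasurableSet M) {ε : ℝ}
    (hε : 0 ≤ ε) :
    (Measure.pi fun _ => P) {T : ι → Z |
      ((Finset.univ.filter fun i => T i ∈ M).card : ℝ) ≤ (P.real M - ε) * Fintype.card ι} ≤
      ENNReal.ofReal (Real.exp (-2 * Fintype.card ι * ε ^ 2)) := by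
  set p := P.real M with hp
  have hp0 : 0 ≤ 1 - p := by linarith [measureReal_le_one (μ := P) (s := M)]
  have hp1 : 1 - p ≤ 1 := by linarith [measureReal_nonneg (μ := P) (s := M)]
  set x : ℝ := Real.exp (4 * ε) - 1 with hx
  have hx0 : 0 ≤ x := by
    have := Real.one_le_exp (show 0 ≤ 4 * ε by positivity)
    linarith
  -- Few hits means many misses: the upper tail of the number of points outside `M` is bounded.
  let F : (ι → Z) → ℝ := fun T => Real.exp (4 * ε * (Finset.univ.filter fun i => T i ∉ M).card)
  have hFm : Measurable F := by
    have : Measurable fun T : ι → Z => ((Finset.univ.filter fun i => T i ∉ M).card : ℝ) :=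
      measurable_card_filter _ fun i => hM.compl.preimage (measurable_pi_apply i)
    exact Real.measurable_exp.comp (this.const_mul _)
  have hint : ∫ T, F T ∂(Measure.pi fun _ => P) = (1 + (1 - p) * x) ^ Fintype.card ι := by
    simp only [F]
    simp_rw [exp_card_filter_eq_prod]
    rw [integral_fintype_prod_eq_pow (𝕜 := ℝ) (μ := P)
      (f := fun z => 1 + (Real.exp (4 * ε) - 1) * (if z ∉ M then 1 else 0))]
    congr 1
    have hi : (fun z : Z => if z ∉ M then (1 : ℝ) else 0) = Mᶜ.indicator 1 := by
      funext z; simp [Set.indicator_apply]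
    rw [integral_add (integrable_const _), integral_const_mul, hi, integral_indicator_one hM.compl,
      probReal_compl_eq_one_sub hM]
    · simp [hx, hp]; ring
    · refine Integrable.const_mul ?_ _
      rw [hi]
      exact (integrable_const (1 : ℝ)).indicator hM.compl
  have hFi : Integrable F (Measure.pi fun _ : ι => P) := by
    refine Integrable.of_bound hFm.aestronglyMeasurable (Real.exp (4 * ε * Fintype.card ι))
      (Filter.Eventually.of_forall fun T => ?_)
    rw [Real.norm_eq_abs, abs_of_pos (Real.exp_pos _)]
    refine Real.exp_le_exp.2 (mul_le_mul_of_nonneg_left ?_ (by positivity))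
    exact_mod_cast Finset.card_le_univ _
  have hsub : {T : ι → Z |
      ((Finset.univ.filter fun i => T i ∈ M).card : ℝ) ≤ (p - ε) * Fintype.card ι} ⊆
      {T | Real.exp (4 * ε * ((1 - p + ε) * Fintype.card ι)) ≤ F T} := by
    intro T hT
    simp only [Set.mem_ofPred_eq] at hT ⊢
    refine Real.exp_le_exp.2 (mul_le_mul_of_nonneg_left ?_ (by positivity))
    have h := Finset.card_filter_add_card_filter_not (s := (Finset.univ : Finset ι))
      (fun i => T i ∈ M)
    have h' : ((Finset.univ.filter fun i => T i ∈ M).card : ℝ) +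
        (Finset.univ.filter fun i => T i ∉ M).card = Fintype.card ι := by exact_mod_cast h
    linarith
  refine (measure_mono hsub).trans ?_
  rw [← ofReal_measureReal]
  refine ENNReal.ofReal_le_ofReal ?_
  have hmk := mul_meas_ge_le_integral_of_nonneg (μ := Measure.pi fun _ : ι => P) (f := F)
    (Filter.Eventually.of_forall fun T => (Real.exp_pos _).le) hFi
    (Real.exp (4 * ε * ((1 - p + ε) * Fintype.card ι)))
  rw [hint] at hmk
  have hb : (1 + (1 - p) * x) ^ Fintype.card ι ≤
      Real.exp (4 * ε * (1 - p) + (4 * ε) ^ 2 / 8) ^ Fintype.card ι :=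
    pow_le_pow_left₀ (by positivity) (bernoulli_mgf_le hp0 hp1 _) _
  have h2 : Real.exp (4 * ε * (1 - p) + (4 * ε) ^ 2 / 8) ^ Fintype.card ι =
      Real.exp (4 * ε * ((1 - p + ε) * Fintype.card ι)) *
        Real.exp (-2 * Fintype.card ι * ε ^ 2) := by
    rw [← Real.exp_nat_mul, ← Real.exp_add]
    congr 1
    ring
  exact le_of_mul_le_mul_left (hmk.trans (hb.trans_eq h2)) (Real.exp_pos _)

end Hoeffding

/-! ### Ranks in a pooled sample -/

section Ranks

variable {ι : Type*} [Fintype ι]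

/-- The largest of the low values dominates all the others, so their number is at most its rank.
Ties need no separate treatment. -/
theorem card_low_rank_le (W : ι → ℝ) {κ : ℝ} (hκ : 0 ≤ κ) :
    ((Finset.univ.filter fun i =>
      ((Finset.univ.filter fun l => W l ≤ W i).card : ℝ) < κ).card : ℝ) ≤ κ := by
  set low := Finset.univ.filter fun i => ((Finset.univ.filter fun l => W l ≤ W i).card : ℝ) < κ
    with hlow
  rcases low.eq_empty_or_nonempty with h | h
  · simpa [h] using hκ
  · obtain ⟨i, hi, hmax⟩ := low.exists_max_image W h
    have h1 : low ⊆ Finset.univ.filter fun l => W l ≤ W i := fun l hl => by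
      simpa using hmax l hl
    have h2 : ((Finset.univ.filter fun l => W l ≤ W i).card : ℝ) < κ := by
      simpa [hlow] using hi
    have h3 : (low.card : ℝ) ≤ (Finset.univ.filter fun l => W l ≤ W i).card := by
      exact_mod_cast Finset.card_le_card h1
    linarith

/-- The smallest of the high values has at least `κ` points strictly below it, and none of those is
high. -/
theorem card_high_rank_le (W : ι → ℝ) {κ : ℝ} (hκ : κ ≤ Fintype.card ι) :
    ((Finset.univ.filter fun i =>
      κ ≤ ((Finset.univ.filter fun l => W l < W i).card : ℝ)).card : ℝ) ≤
      Fintype.card ι - κ := by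
  set high := Finset.univ.filter fun i => κ ≤ ((Finset.univ.filter fun l => W l < W i).card : ℝ)
    with hhigh
  rcases high.eq_empty_or_nonempty with h | h
  · simpa [h] using hκ
  · obtain ⟨i, hi, hmin⟩ := high.exists_min_image W h
    have h1 : high ⊆ Finset.univ.filter fun l => ¬ W l < W i := fun l hl => by
      simpa using hmin l hl
    have h2 : κ ≤ ((Finset.univ.filter fun l => W l < W i).card : ℝ) := by
      simpa [hhigh] using hi
    have h3 : (high.card : ℝ) ≤ (Finset.univ.filter fun l => ¬ W l < W i).card := by
      exact_mod_cast Finset.card_le_card h1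
    have h4 := Finset.card_filter_add_card_filter_not (s := (Finset.univ : Finset ι))
      (fun l => W l < W i)
    have h5 : ((Finset.univ.filter fun l => W l < W i).card : ℝ) +
        (Finset.univ.filter fun l => ¬ W l < W i).card = Fintype.card ι := by exact_mod_cast h4
    linarith

/-- If the training part of a pooled sample contains few low ranks and the test part few high ranks,
then few test values exceed the training quantile. -/
theorem card_exceed_lt {n m : ℕ} (hm : 0 < m) (W : Fin n ⊕ Fin m → ℝ) {τ ε κ : ℝ}
    (hκ : κ = (τ - ε) * (n + m)) (h0 : 0 ≤ τ - ε) (h1 : τ - ε ≤ 1)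
    (hlow : ((Finset.univ.filter fun j : Fin n =>
      ((Finset.univ.filter fun l => W l ≤ W (Sum.inl j)).card : ℝ) < κ).card : ℝ) <
        (((Finset.univ.filter fun i =>
          ((Finset.univ.filter fun l => W l ≤ W i).card : ℝ) < κ).card : ℝ) / (n + m) + ε) * n)
    (hhigh : ((Finset.univ.filter fun j : Fin m =>
      κ ≤ ((Finset.univ.filter fun l => W l < W (Sum.inr j)).card : ℝ)).card : ℝ) <
        (((Finset.univ.filter fun i =>
          κ ≤ ((Finset.univ.filter fun l => W l < W i).card : ℝ)).card : ℝ) / (n + m) + ε) * m) :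
    ((Finset.univ.filter fun i : Fin m => τ * n ≤
      ((Finset.univ.filter fun j : Fin n => W (Sum.inl j) < W (Sum.inr i)).card : ℝ)).card : ℝ) <
      (1 - τ + 2 * ε) * m := by
  have hm' : (0 : ℝ) < m := by exact_mod_cast hm
  have hN : (0 : ℝ) < n + m := by positivity
  have a1 := card_low_rank_le W (κ := κ) (by rw [hκ]; positivity)
  have a2 := card_high_rank_le W (κ := κ) (by
    simp only [Fintype.card_sum, Fintype.card_fin, Nat.cast_add, hκ]
    nlinarith)
  simp only [Fintype.card_sum, Fintype.card_fin, Nat.cast_add] at a2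
  have b1 := (div_le_div_iff_of_pos_right hN).2 a1
  have b2 := (div_le_div_iff_of_pos_right hN).2 a2
  have c1 : κ / (n + m) = τ - ε := by rw [hκ]; field_simp
  have c2 : ((n : ℝ) + m - κ) / (n + m) = 1 - τ + ε := by rw [hκ]; field_simp; ring
  rw [c1] at b1
  rw [c2] at b2
  -- Low points are at most a fraction `τ - ε` of the pool, hence fewer than `τ n` of the training
  -- points.
  have d1 : ((Finset.univ.filter fun j : Fin n =>
      ((Finset.univ.filter fun l => W l ≤ W (Sum.inl j)).card : ℝ) < κ).card : ℝ) < τ * n :=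
    hlow.trans_le (mul_le_mul_of_nonneg_right (by linarith) (by positivity))
  have d2 : ((Finset.univ.filter fun j : Fin m =>
      κ ≤ ((Finset.univ.filter fun l => W l < W (Sum.inr j)).card : ℝ)).card : ℝ) <
        (1 - τ + 2 * ε) * m :=
    hhigh.trans_le (mul_le_mul_of_nonneg_right (by linarith) (by positivity))
  refine lt_of_le_of_lt ?_ d2
  norm_cast
  refine Finset.card_le_card fun i hi => ?_
  simp only [Finset.mem_filter, Finset.mem_univ, true_and] at hi ⊢
  -- A test value exceeding `τ n` training values exceeds one that is not low, hence has at least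
  -- `κ` pool values strictly below it and is itself high.
  have hex : ∃ j : Fin n, W (Sum.inl j) < W (Sum.inr i) ∧
      ¬ ((Finset.univ.filter fun l => W l ≤ W (Sum.inl j)).card : ℝ) < κ := by
    by_contra hcon
    push Not at hcon
    have : (Finset.univ.filter fun j : Fin n => W (Sum.inl j) < W (Sum.inr i)) ⊆
        Finset.univ.filter fun j : Fin n =>
          ((Finset.univ.filter fun l => W l ≤ W (Sum.inl j)).card : ℝ) < κ := by
      intro j hj
      simp only [Finset.mem_filter, Finset.mem_univ, true_and] at hj ⊢
      exact hcon j hj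
    have h := Finset.card_le_card this
    have h' : ((Finset.univ.filter fun j : Fin n => W (Sum.inl j) < W (Sum.inr i)).card : ℝ) ≤ _ :=
      Nat.cast_le.2 h
    linarith
  obtain ⟨j, hj1, hj2⟩ := hex
  rw [not_lt] at hj2
  refine hj2.trans ?_
  norm_cast
  refine Finset.card_le_card fun l hl => ?_
  simp only [Finset.mem_filter, Finset.mem_univ, true_and] at hl ⊢
  exact hl.trans_lt hj1

end Ranks

/-! ### From quantiles to counts -/

section Quantile

theorem le_card_lt_of_quantile_lt {n : ℕ} {v : Fin n → ℝ} {τ : ℝ} {t : EReal}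
    (h : quantile v τ < t) :
    τ * n ≤ ((Finset.univ.filter fun i => (v i : EReal) < t).card : ℝ) := by
  obtain ⟨s, hs, hst⟩ := sInf_lt_iff.1 h
  refine le_trans (Set.mem_ofPred.1 hs) ?_
  rw [Nat.card_eq_fintype_card, Fintype.card_subtype]
  norm_cast
  refine Finset.card_le_card fun i hi => ?_
  simp only [Finset.mem_filter, Finset.mem_univ, true_and] at hi ⊢
  exact hi.trans_lt hst

variable {𝒳 : Type*} [MeasurableSpace 𝒳]

/-- The set of points at which the inflated jackknife+ criterion fails, expressed by counting. -/
def RegressionAlgorithm.missSet (A : RegressionAlgorithm 𝒳) {n : ℕ} (α γ : ℝ)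
    (D : Fin n → 𝒳 × ℝ) : Set (𝒳 × ℝ) :=
  {z | (1 - α) * n ≤ ((Finset.univ.filter fun j =>
    A.looResidual D j + γ < |z.2 - A.looFit D j z.1|).card : ℝ)}

/-- Leaving the interval on either side forces enough indices `j` with `|y - μ̂₋ⱼ(x)| > Rⱼ + γ`. The
factor `1 + 1/n` only raises the required count and is dropped here. -/
theorem RegressionAlgorithm.mem_missSet_of_notMem_jackknifePlus (A : RegressionAlgorithm 𝒳) {n : ℕ}
    (hn : 0 < n) {α γ : ℝ} (hα : α ≤ 1) {D : Fin n → 𝒳 × ℝ} {z : 𝒳 × ℝ}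
    (h : z.2 ∉ A.jackknifePlus α γ D z.1) : z ∈ A.missSet α γ D := by
  have hn' : (0 : ℝ) < n := by exact_mod_cast hn
  have hτ : (1 - α) * n ≤ (1 - α) * (1 + 1 / (n : ℝ)) * n := by
    have : (1 - α) * (1 + 1 / (n : ℝ)) * n = (1 - α) * n + (1 - α) := by field_simp
    linarith
  have hmono : ∀ q : Fin n → Prop, [DecidablePred q] →
      (∀ j, q j → A.looResidual D j + γ < |z.2 - A.looFit D j z.1|) →
      (1 - α) * (1 + 1 / (n : ℝ)) * n ≤ ((Finset.univ.filter q).card : ℝ) →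
      z ∈ A.missSet α γ D := by
    intro q _ hq hle
    refine hτ.trans (hle.trans ?_)
    norm_cast
    exact Finset.card_le_card (Finset.monotone_filter_right _ fun j _ hj => hq j hj)
  simp only [jackknifePlus, Set.mem_ofPred, not_and_or, not_le] at h
  rcases h with h | h
  · have h1 : quantile (fun i => -A.looFit D i z.1 + A.looResidual D i)
        ((1 - α) * (1 + 1 / (n : ℝ))) < ((-z.2 - γ : ℝ) : EReal) := by
      by_contra hcon
      rw [not_lt] at hcon
      have h2 := EReal.sub_le_sub (EReal.neg_le_neg_iff.2 hcon) (le_refl (γ : EReal))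
      have h3 : -(((-z.2 - γ : ℝ)) : EReal) - (γ : EReal) = ((z.2 : ℝ) : EReal) := by
        rw [← EReal.coe_neg, ← EReal.coe_sub]
        congr 1
        ring
      rw [h3] at h2
      exact absurd h (not_lt.2 h2)
    refine hmono _ (fun j hj => ?_) (le_card_lt_of_quantile_lt h1)
    rw [EReal.coe_lt_coe_iff] at hj
    have := neg_le_abs (z.2 - A.looFit D j z.1)
    linarith
  · have h1 : quantile (fun i => A.looFit D i z.1 + A.looResidual D i)
        ((1 - α) * (1 + 1 / (n : ℝ))) < ((z.2 - γ : ℝ) : EReal) := by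
      by_contra hcon
      rw [not_lt] at hcon
      have h2 := add_le_add hcon (le_refl (γ : EReal))
      have h3 : ((z.2 - γ : ℝ) : EReal) + (γ : EReal) = ((z.2 : ℝ) : EReal) := by
        rw [← EReal.coe_add]
        congr 1
        ring
      rw [h3] at h2
      exact absurd h (not_lt.2 h2)
    refine hmono _ (fun j hj => ?_) (le_card_lt_of_quantile_lt h1)
    rw [EReal.coe_lt_coe_iff] at hj
    have := le_abs_self (z.2 - A.looFit D j z.1)
    linarith

end Quantile

/-! ### The pooled reference model -/

section Reference

variable {𝒳 : Type*} [MeasurableSpace 𝒳] {ι : Type*} [Fintype ι] [DecidableEq ι]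

/-- The injective ways to choose a sample of size `p` from a pool, avoiding the point `i`. -/
def selections (p : ℕ) (i : ι) : Finset (Fin p → ι) :=
  Finset.univ.filter fun e => Function.Injective e ∧ ∀ j, e j ≠ i

theorem mem_selections {p : ℕ} {i : ι} {e : Fin p → ι} :
    e ∈ selections p i ↔ Function.Injective e ∧ ∀ j, e j ≠ i := by
  simp [selections]

theorem selections_perm (p : ℕ) (σ : Equiv.Perm ι) (i : ι) :
    selections p (σ i) =
      (selections p i).map (Equiv.arrowCongr (Equiv.refl (Fin p)) σ).toEmbedding := by
  ext e
  rw [Finset.mem_map_equiv, mem_selections, mem_selections]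
  simp [Equiv.arrowCongr, Function.comp_def, Function.Injective, Equiv.symm_apply_eq]

/-- The prediction at the `i`-th point of a pool, averaged over all the samples of size `p` drawn
from the other points. -/
noncomputable def RegressionAlgorithm.poolFit (A : RegressionAlgorithm 𝒳) (p : ℕ)
    (D : ι → 𝒳 × ℝ) (i : ι) : ℝ :=
  (∑ e ∈ selections p i, A.fit p (D ∘ e) (D i).1) / (selections p i).card

/-- Averaging over all selections erases the distinction between training and test points; this
equivariance makes the pooled residuals exchangeable. -/
theorem RegressionAlgorithm.poolFit_comp_perm (A : RegressionAlgorithm 𝒳) (p : ℕ)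
    (D : ι → 𝒳 × ℝ) (σ : Equiv.Perm ι) (i : ι) :
    A.poolFit p (D ∘ σ) i = A.poolFit p D (σ i) := by
  rw [poolFit, poolFit, selections_perm, Finset.sum_map, Finset.card_map]
  rfl

omit [Fintype ι] [DecidableEq ι] in
theorem RegressionAlgorithm.measurable_fit_comp (A : RegressionAlgorithm 𝒳) {p : ℕ}
    (e : Fin p → ι) (i : ι) : Measurable fun D : ι → 𝒳 × ℝ => A.fit p (D ∘ e) (D i).1 :=
  (A.measurable_fit_fst p).comp ((measurable_comp_index e).prodMk (measurable_pi_apply i))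

theorem RegressionAlgorithm.measurable_poolFit (A : RegressionAlgorithm 𝒳) (p : ℕ) (i : ι) :
    Measurable fun D : ι → 𝒳 × ℝ => A.poolFit p D i :=
  (Finset.measurable_sum _ fun e _ => A.measurable_fit_comp e i).div_const _

/-- The distance to an average is at most the average distance, and any two selections avoiding `i`
differ in at most `m` points. -/
theorem RegressionAlgorithm.lintegral_abs_sub_poolFit_le (A : RegressionAlgorithm 𝒳)
    (P : Measure (𝒳 × ℝ)) [IsProbabilityMeasure P] {p m : ℕ} (hmp : m ≤ p)
    (hcard : Fintype.card ι ≤ p + m + 1) {i : ι} {e : Fin p → ι} (he : e ∈ selections p i) :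
    ∫⁻ D : ι → 𝒳 × ℝ, ENNReal.ofReal |A.fit p (D ∘ e) (D i).1 - A.poolFit p D i|
      ∂(Measure.pi fun _ => P) ≤ swapStability A P m p := by
  set K := (selections p i).card with hK
  have hK0 : 0 < K := Finset.card_pos.2 ⟨e, he⟩
  have hK0' : (0 : ℝ) < K := by exact_mod_cast hK0
  have hKe : (K : ℝ≥0∞) ≠ 0 := by exact_mod_cast hK0.ne'
  have hpt : ∀ D : ι → 𝒳 × ℝ,
      (K : ℝ≥0∞) * ENNReal.ofReal |A.fit p (D ∘ e) (D i).1 - A.poolFit p D i| ≤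
        ∑ e' ∈ selections p i,
          ENNReal.ofReal |A.fit p (D ∘ e) (D i).1 - A.fit p (D ∘ e') (D i).1| := by
    intro D
    rw [← ENNReal.ofReal_natCast, ← ENNReal.ofReal_mul (by positivity),
      ← ENNReal.ofReal_sum_of_nonneg fun _ _ => abs_nonneg _]
    refine ENNReal.ofReal_le_ofReal ?_
    have : (K : ℝ) * |A.fit p (D ∘ e) (D i).1 - A.poolFit p D i| =
        |∑ e' ∈ selections p i, (A.fit p (D ∘ e) (D i).1 - A.fit p (D ∘ e') (D i).1)| := by
      rw [← abs_of_pos hK0', ← abs_mul, Finset.sum_sub_distrib, Finset.sum_const,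
        nsmul_eq_mul, poolFit, ← hK]
      congr 1
      field_simp
    rw [this]
    exact Finset.abs_sum_le_sum_abs _ _
  have hpair : ∀ e' ∈ selections p i,
      ∫⁻ D : ι → 𝒳 × ℝ, ENNReal.ofReal |A.fit p (D ∘ e) (D i).1 - A.fit p (D ∘ e') (D i).1|
        ∂(Measure.pi fun _ => P) ≤ swapStability A P m p := by
    intro e' he'
    rw [mem_selections] at he he'
    rw [swapStability_eq_swapDist]
    refine lintegral_pair_le_swapDist (f := fun D z => A.fit p D z.1) (A.measurable_fit_fst p)
      (fun π D => by rw [A.fit_comp_perm]) he.1 he'.1 he.2 he'.2 ?_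
    rw [card_filter_last hmp, ← Finset.card_image_of_injective _ he'.1]
    -- New points avoid both `i` and the `p` points of `e`, which leaves at most `(p + m + 1) - (p +
    -- 1) = m`.
    have hsub : (Finset.univ.filter fun j => e' j ∉ Finset.univ.image e).image e' ⊆
        (insert i (Finset.univ.image e))ᶜ := by
      intro k hk
      obtain ⟨j, hj, rfl⟩ := Finset.mem_image.1 hk
      rw [Finset.mem_compl, Finset.mem_insert, not_or]
      exact ⟨he'.2 j, (Finset.mem_filter.1 hj).2⟩
    refine (Finset.card_le_card hsub).trans ?_
    rw [Finset.card_compl, Finset.card_insert_of_notMem (by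
      simpa using he.2), Finset.card_image_of_injective _ he.1, Finset.card_univ, Fintype.card_fin]
    omega
  have hm : ∀ e' : Fin p → ι, Measurable fun D : ι → 𝒳 × ℝ =>
      ENNReal.ofReal |A.fit p (D ∘ e) (D i).1 - A.fit p (D ∘ e') (D i).1| := fun e' =>
    (measurable_norm.comp
      ((A.measurable_fit_comp e i).sub (A.measurable_fit_comp e' i))).ennreal_ofReal
  refine (ENNReal.mul_le_mul_iff_right hKe (ENNReal.natCast_ne_top K)).1 ?_
  calc (K : ℝ≥0∞) * ∫⁻ D : ι → 𝒳 × ℝ,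
        ENNReal.ofReal |A.fit p (D ∘ e) (D i).1 - A.poolFit p D i| ∂(Measure.pi fun _ => P)
      = ∫⁻ D : ι → 𝒳 × ℝ, K * ENNReal.ofReal |A.fit p (D ∘ e) (D i).1 - A.poolFit p D i|
          ∂(Measure.pi fun _ => P) := (lintegral_const_mul' _ _ (ENNReal.natCast_ne_top K)).symm
    _ ≤ ∫⁻ D : ι → 𝒳 × ℝ, ∑ e' ∈ selections p i,
          ENNReal.ofReal |A.fit p (D ∘ e) (D i).1 - A.fit p (D ∘ e') (D i).1|
          ∂(Measure.pi fun _ => P) := lintegral_mono hpt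
    _ ≤ ∑ e' ∈ selections p i, swapStability A P m p := by
        rw [lintegral_finsetSum _ fun e' _ => hm e']
        exact Finset.sum_le_sum hpair
    _ = K * swapStability A P m p := by rw [Finset.sum_const, nsmul_eq_mul]

end Reference

/-! ### Leave-one-out models against the pooled model -/

section TrainingConditional

variable {𝒳 : Type*} [MeasurableSpace 𝒳]

/-- The positions, in a pool of `n` training and `m` test points, of the training points other than
the `j`-th one. -/
def looSelection {n : ℕ} (m : ℕ) (j : Fin n) : Fin (n - 1) → Fin n ⊕ Fin m := fun k =>
  Sum.inl (leaveOneOut (fun l => l) j k)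

theorem leaveOneOut_eq_comp {Z : Type*} {n : ℕ} (D : Fin n → Z) (j : Fin n) :
    leaveOneOut D j = D ∘ leaveOneOut (fun l => l) j := by
  funext k
  simp only [leaveOneOut, Function.comp_apply]
  split_ifs <;> rfl

theorem comp_looSelection {Z : Type*} {n m : ℕ} (D : Fin n ⊕ Fin m → Z) (j : Fin n) :
    D ∘ looSelection m j = leaveOneOut (D ∘ Sum.inl) j :=
  (leaveOneOut_eq_comp (D ∘ Sum.inl) j).symm

theorem looSelection_injective {n m : ℕ} (j : Fin n) : Function.Injective (looSelection m j) := by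
  intro a b h
  have h' := Sum.inl_injective h
  simp only [leaveOneOut] at h'
  ext
  split_ifs at h' <;> simp only [Fin.mk.injEq] at h' <;> omega

theorem looSelection_ne_inl {n m : ℕ} (j : Fin n) (k : Fin (n - 1)) :
    looSelection m j k ≠ Sum.inl j := by
  intro h
  have h' := Sum.inl_injective h
  simp only [leaveOneOut] at h'
  split_ifs at h' <;> simp only [Fin.ext_iff] at h' <;> omega

theorem looSelection_mem_inl {n m : ℕ} (j : Fin n) :
    looSelection m j ∈ selections (n - 1) (Sum.inl j : Fin n ⊕ Fin m) :=
  mem_selections.2 ⟨looSelection_injective j, looSelection_ne_inl j⟩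

theorem looSelection_mem_inr {n m : ℕ} (j : Fin n) (i : Fin m) :
    looSelection m j ∈ selections (n - 1) (Sum.inr i : Fin n ⊕ Fin m) :=
  mem_selections.2 ⟨looSelection_injective j, fun _ => by simp [looSelection]⟩

namespace RegressionAlgorithm

variable (A : RegressionAlgorithm 𝒳)

/-- The total discrepancy, at the `i`-th test point and the `j`-th training point, between the
`j`-th leave-one-out model and the pooled model. -/
noncomputable def discrepancy {n m : ℕ} (j : Fin n) (i : Fin m)
    (D : Fin n ⊕ Fin m → 𝒳 × ℝ) : ℝ :=
  |A.fit (n - 1) (D ∘ looSelection m j) (D (Sum.inr i)).1 - A.poolFit (n - 1) D (Sum.inr i)| +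
    |A.fit (n - 1) (D ∘ looSelection m j) (D (Sum.inl j)).1 - A.poolFit (n - 1) D (Sum.inl j)|

/-- The residual at a point of a pool of the pooled model. -/
noncomputable def poolResidual {ι : Type*} [Fintype ι] [DecidableEq ι] (p : ℕ)
    (D : ι → 𝒳 × ℝ) (i : ι) : ℝ :=
  |(D i).2 - A.poolFit p D i|

theorem measurable_discrepancy {n m : ℕ} (j : Fin n) (i : Fin m) :
    Measurable (A.discrepancy j i) :=
  (measurable_norm.comp ((A.measurable_fit_comp _ _).sub (A.measurable_poolFit _ _))).add
    (measurable_norm.comp ((A.measurable_fit_comp _ _).sub (A.measurable_poolFit _ _)))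

theorem measurable_poolResidual {ι : Type*} [Fintype ι] [DecidableEq ι] (p : ℕ) (i : ι) :
    Measurable fun D : ι → 𝒳 × ℝ => A.poolResidual p D i :=
  measurable_norm.comp ((measurable_snd.comp (measurable_pi_apply i)).sub
    (A.measurable_poolFit p i))

theorem lintegral_discrepancy_le (P : Measure (𝒳 × ℝ)) [IsProbabilityMeasure P] {n m : ℕ}
    (hmn : m ≤ n - 1) (j : Fin n) (i : Fin m) :
    ∫⁻ D, ENNReal.ofReal (A.discrepancy j i D) ∂(Measure.pi fun _ => P) ≤
      2 * swapStability A P m (n - 1) := by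
  have hcard : Fintype.card (Fin n ⊕ Fin m) ≤ n - 1 + m + 1 := by
    simp only [Fintype.card_sum, Fintype.card_fin]
    omega
  have h1 := A.lintegral_abs_sub_poolFit_le P hmn hcard (looSelection_mem_inr j i)
  have h2 := A.lintegral_abs_sub_poolFit_le P hmn hcard (looSelection_mem_inl (m := m) j)
  simp only [discrepancy]
  simp_rw [ENNReal.ofReal_add (abs_nonneg _) (abs_nonneg _)]
  rw [lintegral_add_left, two_mul]
  · exact add_le_add h1 h2
  · exact (measurable_norm.comp
      ((A.measurable_fit_comp _ _).sub (A.measurable_poolFit _ _))).ennreal_ofReal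

theorem measurable_looFit {n : ℕ} (j : Fin n) :
    Measurable fun q : (Fin n → 𝒳 × ℝ) × 𝒳 => A.looFit q.1 j q.2 := by
  have h : Measurable fun D : Fin n → 𝒳 × ℝ => leaveOneOut D j := by
    rw [funext fun D : Fin n → 𝒳 × ℝ => leaveOneOut_eq_comp D j]
    exact measurable_comp_index _
  exact (A.measurable_fit (n - 1)).comp ((h.comp measurable_fst).prodMk measurable_snd)

theorem measurable_looResidual {n : ℕ} (j : Fin n) :
    Measurable fun D : Fin n → 𝒳 × ℝ => A.looResidual D j := by
  have h := (A.measurable_looFit j).comp (measurable_id.prodMk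
    (measurable_fst.comp (measurable_pi_apply j)) :
      Measurable fun D : Fin n → 𝒳 × ℝ => (D, (D j).1))
  exact measurable_norm.comp ((measurable_snd.comp (measurable_pi_apply j)).sub h)

theorem measurableSet_missSet {n : ℕ} (α γ : ℝ) :
    MeasurableSet {q : (Fin n → 𝒳 × ℝ) × (𝒳 × ℝ) | q.2 ∈ A.missSet α γ q.1} := by
  refine measurableSet_le measurable_const (measurable_card_filter _ fun j => ?_)
  refine measurableSet_lt (((A.measurable_looResidual j).comp measurable_fst).add_const γ) ?_
  have h := (A.measurable_looFit j).comp ((measurable_fst).prodMk (measurable_snd.fst) :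
    Measurable fun q : (Fin n → 𝒳 × ℝ) × (𝒳 × ℝ) => (q.1, q.2.1))
  exact measurable_norm.comp (measurable_snd.snd.sub h)

/-- At a test point missed by the jackknife+ criterion, the pooled residual exceeds those of all the
training points that are counted and have small discrepancy. -/
theorem le_card_poolResidual_lt {n m : ℕ} {α γ a : ℝ} {D : Fin n ⊕ Fin m → 𝒳 × ℝ} {i : Fin m}
    (hmiss : D (Sum.inr i) ∈ A.missSet α γ (D ∘ Sum.inl))
    (hbad : ((Finset.univ.filter fun j : Fin n => γ < A.discrepancy j i D).card : ℝ) ≤ a * n) :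
    (1 - α - a) * n ≤ ((Finset.univ.filter fun j : Fin n =>
      A.poolResidual (n - 1) D (Sum.inl j) < A.poolResidual (n - 1) D (Sum.inr i)).card : ℝ) := by
  have hmiss' : (1 - α) * n ≤ ((Finset.univ.filter fun j => A.looResidual (D ∘ Sum.inl) j + γ <
      |(D (Sum.inr i)).2 - A.looFit (D ∘ Sum.inl) j (D (Sum.inr i)).1|).card : ℝ) := hmiss
  have hsub : (Finset.univ.filter fun j => A.looResidual (D ∘ Sum.inl) j + γ <
      |(D (Sum.inr i)).2 - A.looFit (D ∘ Sum.inl) j (D (Sum.inr i)).1|) ⊆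
      (Finset.univ.filter fun j : Fin n => γ < A.discrepancy j i D) ∪
      (Finset.univ.filter fun j : Fin n =>
        A.poolResidual (n - 1) D (Sum.inl j) < A.poolResidual (n - 1) D (Sum.inr i)) := by
    intro j hj
    simp only [Finset.mem_union, Finset.mem_filter, Finset.mem_univ, true_and] at hj ⊢
    by_contra hcon
    rw [not_or, not_lt, not_lt] at hcon
    simp only [discrepancy, poolResidual, looResidual, looFit, comp_looSelection,
      Function.comp_apply] at hj hcon
    set u := A.fit (n - 1) (leaveOneOut (D ∘ Sum.inl) j) (D (Sum.inr i)).1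
    set v := A.fit (n - 1) (leaveOneOut (D ∘ Sum.inl) j) (D (Sum.inl j)).1
    -- Replacing the leave-one-out model by the pooled one changes the two residuals by at most the
    -- discrepancy in total, which is absorbed by the margin `γ`.
    have h1 := abs_sub_le (D (Sum.inr i)).2 (A.poolFit (n - 1) D (Sum.inr i)) u
    have h2 := abs_sub_le (D (Sum.inl j)).2 v (A.poolFit (n - 1) D (Sum.inl j))
    rw [abs_sub_comm (A.poolFit (n - 1) D (Sum.inr i)) u] at h1
    linarith [hcon.1, hcon.2]
  have hc := (Finset.card_le_card hsub).trans (Finset.card_union_le _ _)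
  have hc' : ((Finset.univ.filter fun j => A.looResidual (D ∘ Sum.inl) j + γ <
      |(D (Sum.inr i)).2 - A.looFit (D ∘ Sum.inl) j (D (Sum.inr i)).1|).card : ℝ) ≤
      (Finset.univ.filter fun j : Fin n => γ < A.discrepancy j i D).card +
      (Finset.univ.filter fun j : Fin n =>
        A.poolResidual (n - 1) D (Sum.inl j) < A.poolResidual (n - 1) D (Sum.inr i)).card := by
    exact_mod_cast hc
  linarith

end RegressionAlgorithm

/-- Markov's inequality over the test points: `a² = a · a`. -/
theorem card_filter_row_gt_le {n m : ℕ} (hn : 0 < n) {a : ℝ} (ha : 0 ≤ a) (r : Fin m → ℕ)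
    (h : ((∑ i, r i : ℕ) : ℝ) ≤ a ^ 2 * (n * m)) :
    ((Finset.univ.filter fun i => a * n < r i).card : ℝ) ≤ a * m := by
  have hn' : (0 : ℝ) < n := by exact_mod_cast hn
  rcases ha.eq_or_lt with rfl | ha
  · have h0 : ∑ i, r i = 0 := by
      have : ((∑ i, r i : ℕ) : ℝ) ≤ 0 := by simpa using h
      exact Nat.le_zero.1 (by exact_mod_cast this)
    simp only [Finset.sum_eq_zero_iff, Finset.mem_univ, true_imp_iff] at h0
    simp [h0]
  · have h1 : ((Finset.univ.filter fun i => a * n < r i).card : ℝ) * (a * n) ≤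
        ((∑ i, r i : ℕ) : ℝ) := by
      rw [← nsmul_eq_mul, ← Finset.sum_const, Nat.cast_sum]
      refine (Finset.sum_le_sum fun i hi => ((Finset.mem_filter.1 hi).2).le).trans ?_
      exact Finset.sum_le_univ_sum_of_nonneg fun i => Nat.cast_nonneg _
    refine le_of_mul_le_mul_right (h1.trans (h.trans_eq ?_)) (mul_pos ha hn')
    ring

/-- The expected fraction of bad pairs is at most `a³ = a² · a`, so it exceeds `a²` with probability
at most `a`. This splitting is the origin of the cube root. -/
theorem measure_card_bad_pairs_gt_le {Ω : Type*} [MeasurableSpace Ω] {μ : Measure Ω} {n m : ℕ}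
    (hn : 0 < n) (hm : 0 < m) {a : ℝ} (ha : 0 ≤ a) {d : Fin n → Fin m → Ω → ℝ} {γ : ℝ}
    (hd : ∀ j i, Measurable (d j i))
    (hbad : ∀ j i, μ {ω | γ < d j i ω} ≤ ENNReal.ofReal (a ^ 3)) :
    μ {ω | a ^ 2 * (n * m) < ((∑ i, (Finset.univ.filter fun j => γ < d j i ω).card : ℕ) : ℝ)} ≤
      ENNReal.ofReal a := by
  rcases ha.eq_or_lt with rfl | ha
  -- For `a = 0` Markov would divide by zero; a finite union of null events is used instead.
  · have hsub : {ω | (0 : ℝ) ^ 2 * (n * m) <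
        ((∑ i, (Finset.univ.filter fun j => γ < d j i ω).card : ℕ) : ℝ)} ⊆
        ⋃ i, ⋃ j, {ω | γ < d j i ω} := by
      intro ω hω
      by_contra hcon
      simp only [Set.mem_iUnion, Set.mem_ofPred_eq, not_exists] at hcon
      simp [hcon] at hω
    refine (measure_mono hsub).trans ?_
    simp only [ENNReal.ofReal_zero, nonpos_iff_eq_zero, measure_iUnion_null_iff]
    exact fun i j => by simpa using hbad j i
  · have hm' (j i) : MeasurableSet {ω | γ < d j i ω} := measurableSet_lt measurable_const (hd j i)
    have hcount : ∀ ω, ENNReal.ofReal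
        ((∑ i, (Finset.univ.filter fun j => γ < d j i ω).card : ℕ) : ℝ) =
        ∑ i, ∑ j, {ω | γ < d j i ω}.indicator (1 : Ω → ℝ≥0∞) ω := by
      intro ω
      rw [ENNReal.ofReal_natCast, Nat.cast_sum]
      refine Finset.sum_congr rfl fun i _ => ?_
      rw [Finset.card_filter, Nat.cast_sum]
      refine Finset.sum_congr rfl fun j _ => ?_
      simp [Set.indicator_apply]
    have hmeas : Measurable fun ω =>
        ∑ i, ∑ j, {ω | γ < d j i ω}.indicator (1 : Ω → ℝ≥0∞) ω :=
      Finset.measurable_sum _ fun i _ => Finset.measurable_sum _ fun j _ =>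
        measurable_one.indicator (hm' j i)
    have hpos : 0 < a ^ 2 * (n * m : ℝ) := by positivity
    have hmk := mul_meas_ge_le_lintegral (μ := μ) hmeas (ENNReal.ofReal (a ^ 2 * (n * m)))
    have hint : ∫⁻ ω, ∑ i, ∑ j, {ω | γ < d j i ω}.indicator (1 : Ω → ℝ≥0∞) ω ∂μ ≤
        ENNReal.ofReal (a ^ 2 * (n * m)) * ENNReal.ofReal a := by
      rw [lintegral_finsetSum _ fun i _ => Finset.measurable_sum _ fun j _ =>
        measurable_one.indicator (hm' j i)]
      calc ∑ i, ∫⁻ ω, ∑ j, {ω | γ < d j i ω}.indicator (1 : Ω → ℝ≥0∞) ω ∂μ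
          ≤ ∑ _i : Fin m, ∑ _j : Fin n, ENNReal.ofReal (a ^ 3) := by
            refine Finset.sum_le_sum fun i _ => ?_
            rw [lintegral_finsetSum _ fun j _ => measurable_one.indicator (hm' j i)]
            refine Finset.sum_le_sum fun j _ => ?_
            rw [lintegral_indicator_one (hm' j i)]
            exact hbad j i
        _ = ENNReal.ofReal (a ^ 2 * (n * m)) * ENNReal.ofReal a := by
            simp only [Finset.sum_const, Finset.card_univ, Fintype.card_fin, nsmul_eq_mul]
            rw [← ENNReal.ofReal_natCast n, ← ENNReal.ofReal_natCast m,
              ← ENNReal.ofReal_mul (by positivity), ← ENNReal.ofReal_mul (by positivity),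
              ← ENNReal.ofReal_mul (by positivity)]
            congr 1
            ring
    have hsub : {ω | a ^ 2 * (n * m) <
        ((∑ i, (Finset.univ.filter fun j => γ < d j i ω).card : ℕ) : ℝ)} ⊆
        {ω | ENNReal.ofReal (a ^ 2 * (n * m)) ≤
          ∑ i, ∑ j, {ω | γ < d j i ω}.indicator (1 : Ω → ℝ≥0∞) ω} := by
      intro ω hω
      rw [Set.mem_ofPred_eq] at hω ⊢
      rw [← hcount]
      exact ENNReal.ofReal_le_ofReal hω.le
    refine (measure_mono hsub).trans ?_
    exact (ENNReal.mul_le_mul_iff_right (by simpa using hpos) ENNReal.ofReal_ne_top).1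
      (hmk.trans hint)

end TrainingConditional

/-! ### The ghost-sample argument -/

section Main

variable {𝒳 : Type*} [MeasurableSpace 𝒳]

/-- Given the training sample, `M` is a fixed set and the test points are i.i.d., so Hoeffding
applies on each fibre. -/
theorem measure_test_fraction_le {Z : Type*} [MeasurableSpace Z] (P : Measure Z)
    [IsProbabilityMeasure P] {n m : ℕ} {M : (Fin n → Z) → Set Z}
    [∀ D, DecidablePred (· ∈ M D)]
    (hM : MeasurableSet {q : (Fin n → Z) × Z | q.2 ∈ M q.1}) {ε : ℝ} (hε : 0 ≤ ε) :
    (Measure.pi fun _ => P) {D : Fin n ⊕ Fin m → Z |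
      ((Finset.univ.filter fun i : Fin m => D (Sum.inr i) ∈ M (D ∘ Sum.inl)).card : ℝ) ≤
        (P.real (M (D ∘ Sum.inl)) - ε) * m} ≤ ENNReal.ofReal (Real.exp (-2 * m * ε ^ 2)) := by
  have hP : Measurable fun D : Fin n → Z => P.real (M D) :=
    (measurable_measure_prodMk_left hM).ennreal_toReal
  set S := {D : Fin n ⊕ Fin m → Z |
      ((Finset.univ.filter fun i : Fin m => D (Sum.inr i) ∈ M (D ∘ Sum.inl)).card : ℝ) ≤
        (P.real (M (D ∘ Sum.inl)) - ε) * m} with hS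
  have hSm : MeasurableSet S := by
    refine measurableSet_le (measurable_card_filter _ fun i => ?_)
      (((hP.comp (measurable_comp_index _)).sub_const _).mul_const _)
    exact hM.preimage ((measurable_comp_index Sum.inl).prodMk (measurable_pi_apply (Sum.inr i)))
  rw [← lintegral_indicator_one hSm, lintegral_sum_index (measurable_one.indicator hSm)]
  calc ∫⁻ a : Fin n → Z, ∫⁻ b : Fin m → Z, S.indicator 1 (Sum.elim a b)
        ∂(Measure.pi fun _ => P) ∂(Measure.pi fun _ => P)
      ≤ ∫⁻ _ : Fin n → Z, ENNReal.ofReal (Real.exp (-2 * m * ε ^ 2))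
          ∂(Measure.pi fun _ => P) := by
        refine lintegral_mono fun a => ?_
        have hsec : MeasurableSet ((fun b : Fin m → Z => Sum.elim a b) ⁻¹' S) :=
          hSm.preimage (measurable_sumElim measurable_const measurable_id)
        have h1 : ∫⁻ b : Fin m → Z, S.indicator 1 (Sum.elim a b) ∂(Measure.pi fun _ => P) =
            (Measure.pi fun _ => P) ((fun b : Fin m → Z => Sum.elim a b) ⁻¹' S) := by
          rw [← lintegral_indicator_one hsec]
          rfl
        rw [h1]
        have h2 := measure_iid_card_le_le (P := P) (ι := Fin m) (M := M a)
          (hM.preimage measurable_prodMk_left) hε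
        simp only [Fintype.card_fin] at h2
        exact h2
    _ = ENNReal.ofReal (Real.exp (-2 * m * ε ^ 2)) := by
        rw [lintegral_const, measure_univ, mul_one]

theorem exp_neg_two_mul_sqrt_le {k m : ℕ} (hm : 0 < m) (hmk : m ≤ k) {δ : ℝ} (h0 : 0 < δ)
    (h1 : δ < 1) : Real.exp (-2 * k * √(Real.log (1 / δ) / (2 * m)) ^ 2) ≤ δ := by
  have hm' : (0 : ℝ) < m := by exact_mod_cast hm
  have hk : (m : ℝ) ≤ k := by exact_mod_cast hmk
  have hl : 0 < Real.log (1 / δ) := Real.log_pos (by rw [lt_div_iff₀ h0]; linarith)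
  rw [Real.sq_sqrt (by positivity)]
  calc Real.exp (-2 * k * (Real.log (1 / δ) / (2 * m)))
      ≤ Real.exp (-Real.log (1 / δ)) := by
        refine Real.exp_le_exp.2 ?_
        have : -2 * (k : ℝ) * (Real.log (1 / δ) / (2 * m)) = -(k / m * Real.log (1 / δ)) := by
          field_simp
        rw [this, neg_le_neg_iff]
        exact le_mul_of_one_le_left hl.le ((one_le_div hm').2 hk)
    _ = δ := by
        rw [one_div, Real.log_inv, neg_neg, Real.exp_log h0]

/-- The training-conditional guarantee, in terms of a bound `a ^ 3` on the probability that a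
leave-one-out model is far from the pooled model. -/
theorem RegressionAlgorithm.measure_le_miscoverage_le (A : RegressionAlgorithm 𝒳)
    (P : Measure (𝒳 × ℝ)) [IsProbabilityMeasure P] {n m : ℕ} (hm : 0 < m) (hmn : m ≤ n - 1)
    {α γ δ a : ℝ} (hα0 : 0 ≤ α) (hα1 : α ≤ 1) (hδ0 : 0 < δ) (hδ1 : δ < 1) (ha : 0 ≤ a)
    (hbad : ∀ (j : Fin n) (i : Fin m), (Measure.pi fun _ => P)
      {D : Fin n ⊕ Fin m → 𝒳 × ℝ | γ < A.discrepancy j i D} ≤ ENNReal.ofReal (a ^ 3)) :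
    iidLaw P n {D | ENNReal.ofReal
        (α + 3 * √(Real.log (1 / δ) / (2 * (min n m : ℕ))) + 2 * a) ≤ A.miscoverage P α γ D} ≤
      ENNReal.ofReal (3 * δ + a) := by
  classical
  have hn : 0 < n := by omega
  have hmn' : m ≤ n := by omega
  rw [min_eq_right hmn']
  set ε : ℝ := √(Real.log (1 / δ) / (2 * m)) with hε
  have hm' : (0 : ℝ) < m := by exact_mod_cast hm
  have hn' : (0 : ℝ) < n := by exact_mod_cast hn
  have hε0 : 0 < ε := by
    have hl : 0 < Real.log (1 / δ) := Real.log_pos (by rw [lt_div_iff₀ hδ0]; linarith)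
    exact Real.sqrt_pos.2 (by positivity)
  have hmis : ∀ D : Fin n → 𝒳 × ℝ, A.miscoverage P α γ D ≤ P (A.missSet α γ D) := fun D =>
    measure_mono fun z hz => A.mem_missSet_of_notMem_jackknifePlus hn hα1 hz
  -- In this case the threshold `α + 3ε + 2a` exceeds `1`, so the event is empty. Otherwise the rank
  -- level `τ - ε`, with `τ = 1 - α - a`, is admissible.
  by_cases htriv : 1 - α - a - ε ≤ 0
  · have : {D : Fin n → 𝒳 × ℝ | ENNReal.ofReal (α + 3 * ε + 2 * a) ≤ A.miscoverage P α γ D} =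
        ∅ := by
      rw [Set.eq_empty_iff_forall_notMem]
      intro D hD
      have h1 : A.miscoverage P α γ D ≤ 1 := prob_le_one
      have h2 : ENNReal.ofReal (α + 3 * ε + 2 * a) ≤ 1 := le_trans hD h1
      rw [ENNReal.ofReal_le_one] at h2
      linarith
    rw [this, measure_empty]
    exact zero_le
  push Not at htriv
  set κ : ℝ := (1 - α - a - ε) * (n + m) with hκ
  let W : (Fin n ⊕ Fin m → 𝒳 × ℝ) → Fin n ⊕ Fin m → ℝ := fun D i => A.poolResidual (n - 1) D i
  have hWm : ∀ i, Measurable fun D => W D i := fun i => A.measurable_poolResidual _ i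
  have hWσ : ∀ (σ : Equiv.Perm (Fin n ⊕ Fin m)) (D : Fin n ⊕ Fin m → 𝒳 × ℝ) (i), W (D ∘ σ) i =
      W D (σ i) := by
    intro σ D i
    simp only [W, poolResidual, A.poolFit_comp_perm, Function.comp_apply]
  let low : (Fin n ⊕ Fin m → 𝒳 × ℝ) → Finset (Fin n ⊕ Fin m) := fun D =>
    Finset.univ.filter fun i => ((Finset.univ.filter fun l => W D l ≤ W D i).card : ℝ) < κ
  let high : (Fin n ⊕ Fin m → 𝒳 × ℝ) → Finset (Fin n ⊕ Fin m) := fun D =>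
    Finset.univ.filter fun i => κ ≤ ((Finset.univ.filter fun l => W D l < W D i).card : ℝ)
  let train : Finset (Fin n ⊕ Fin m) := Finset.univ.map Function.Embedding.inl
  let test : Finset (Fin n ⊕ Fin m) := Finset.univ.map Function.Embedding.inr
  -- The four failures: too many bad pairs, too many low ranks in training, too many high ranks in
  -- test, too few misses among the test points.
  let E₁ : Set (Fin n ⊕ Fin m → 𝒳 × ℝ) := {D | a ^ 2 * (n * m) <
    ((∑ i : Fin m, (Finset.univ.filter fun j : Fin n => γ < A.discrepancy j i D).card : ℕ) : ℝ)}
  let E₂ : Set (Fin n ⊕ Fin m → 𝒳 × ℝ) := {D | (((low D).card : ℝ) /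
    Fintype.card (Fin n ⊕ Fin m) + ε) * train.card ≤ (train.filter fun i => i ∈ low D).card}
  let E₃ : Set (Fin n ⊕ Fin m → 𝒳 × ℝ) := {D | (((high D).card : ℝ) /
    Fintype.card (Fin n ⊕ Fin m) + ε) * test.card ≤ (test.filter fun i => i ∈ high D).card}
  let E₄ : Set (Fin n ⊕ Fin m → 𝒳 × ℝ) := {D |
    ((Finset.univ.filter fun i : Fin m =>
      D (Sum.inr i) ∈ A.missSet α γ (D ∘ Sum.inl)).card : ℝ) ≤
        (P.real (A.missSet α γ (D ∘ Sum.inl)) - ε) * m}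
  have h1 : (Measure.pi fun _ => P) E₁ ≤ ENNReal.ofReal a :=
    measure_card_bad_pairs_gt_le hn hm ha (fun j i => A.measurable_discrepancy j i) hbad
  have hexpm := exp_neg_two_mul_sqrt_le hm le_rfl hδ0 hδ1
  have hexpn := exp_neg_two_mul_sqrt_le hm hmn' hδ0 hδ1
  have htrain : train.card = n := by simp [train]
  have htest : test.card = m := by simp [test]
  have hcardσ : ∀ (σ : Equiv.Perm (Fin n ⊕ Fin m)) (q : Fin n ⊕ Fin m → Prop) [DecidablePred q],
      (Finset.univ.filter fun l => q (σ l)).card = (Finset.univ.filter q).card := by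
    intro σ q _
    rw [Finset.card_filter, Finset.card_filter]
    exact Equiv.sum_comp σ fun l => if q l then 1 else 0
  have h2 : (Measure.pi fun _ => P) E₂ ≤ ENNReal.ofReal δ := by
    refine (measure_exchangeable_ge_le (P := P) (c := low) ?_ ?_ train hε0.le).trans ?_
    · intro i
      simp only [low, Finset.mem_filter, Finset.mem_univ, true_and]
      exact measurableSet_lt (measurable_card_filter _ fun l => measurableSet_le (hWm l) (hWm i))
        measurable_const
    · intro σ D i
      simp only [low, Finset.mem_filter, Finset.mem_univ, true_and, hWσ]
      rw [hcardσ σ fun l => W D l ≤ W D (σ i)]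
    · rw [htrain]
      exact ENNReal.ofReal_le_ofReal hexpn
  have h3 : (Measure.pi fun _ => P) E₃ ≤ ENNReal.ofReal δ := by
    refine (measure_exchangeable_ge_le (P := P) (c := high) ?_ ?_ test hε0.le).trans ?_
    · intro i
      simp only [high, Finset.mem_filter, Finset.mem_univ, true_and]
      exact measurableSet_le measurable_const
        (measurable_card_filter _ fun l => measurableSet_lt (hWm l) (hWm i))
    · intro σ D i
      simp only [high, Finset.mem_filter, Finset.mem_univ, true_and, hWσ]
      rw [hcardσ σ fun l => W D l < W D (σ i)]
    · rw [htest]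
      exact ENNReal.ofReal_le_ofReal hexpm
  have h4 : (Measure.pi fun _ => P) E₄ ≤ ENNReal.ofReal δ :=
    (measure_test_fraction_le P (A.measurableSet_missSet α γ) hε0.le).trans
      (ENNReal.ofReal_le_ofReal hexpm)
  -- Transfer to the pool requires a measurable event, so the miscoverage is first replaced by the
  -- larger `P (missSet)`, measurable in `D`.
  have hT : MeasurableSet {D : Fin n → 𝒳 × ℝ |
      ENNReal.ofReal (α + 3 * ε + 2 * a) ≤ P (A.missSet α γ D)} :=
    measurableSet_le measurable_const
      (measurable_measure_prodMk_left (A.measurableSet_missSet α γ))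
  have hsub : (fun D : Fin n ⊕ Fin m → 𝒳 × ℝ => D ∘ Sum.inl) ⁻¹' {D : Fin n → 𝒳 × ℝ |
      ENNReal.ofReal (α + 3 * ε + 2 * a) ≤ P (A.missSet α γ D)} ⊆ E₁ ∪ (E₂ ∪ (E₃ ∪ E₄)) := by
    intro D hD
    by_contra hcon
    simp only [Set.mem_union, not_or] at hcon
    obtain ⟨n1, n2, n3, n4⟩ := hcon
    simp only [E₁, Set.mem_ofPred_eq, not_lt] at n1
    simp only [E₂, Set.mem_ofPred_eq, not_le] at n2
    simp only [E₃, Set.mem_ofPred_eq, not_le] at n3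
    simp only [E₄, Set.mem_ofPred_eq, not_le] at n4
    have hD' : α + 3 * ε + 2 * a ≤ P.real (A.missSet α γ (D ∘ Sum.inl)) :=
      (ENNReal.ofReal_le_iff_le_toReal (measure_ne_top _ _)).1 hD
    have c1 := card_filter_row_gt_le hn ha
      (fun i : Fin m => (Finset.univ.filter fun j : Fin n => γ < A.discrepancy j i D).card) n1
    have c2 := card_exceed_lt hm (W D) (τ := 1 - α - a) (ε := ε) hκ htriv.le (by linarith)
      (by
        simp only [htrain, Fintype.card_sum, Fintype.card_fin, Nat.cast_add] at n2
        rw [Finset.filter_map, Finset.card_map] at n2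
        simpa [low] using n2)
      (by
        simp only [htest, Fintype.card_sum, Fintype.card_fin, Nat.cast_add] at n3
        rw [Finset.filter_map, Finset.card_map] at n3
        simpa [high] using n3)
    have hsub' : (Finset.univ.filter fun i : Fin m =>
        D (Sum.inr i) ∈ A.missSet α γ (D ∘ Sum.inl)) ⊆
        (Finset.univ.filter fun i : Fin m => (1 - α - a) * n ≤ ((Finset.univ.filter
          fun j : Fin n => W D (Sum.inl j) < W D (Sum.inr i)).card : ℝ)) ∪
        (Finset.univ.filter fun i : Fin m => a * n <
          ((Finset.univ.filter fun j : Fin n => γ < A.discrepancy j i D).card : ℝ)) := by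
      intro i hi
      simp only [Finset.mem_union, Finset.mem_filter, Finset.mem_univ, true_and] at hi ⊢
      by_contra hcon
      rw [not_or] at hcon
      exact hcon.1 (A.le_card_poolResidual_lt hi (not_lt.1 hcon.2))
    have c3 := (Finset.card_le_card hsub').trans (Finset.card_union_le _ _)
    have c4 : ((Finset.univ.filter fun i : Fin m =>
        D (Sum.inr i) ∈ A.missSet α γ (D ∘ Sum.inl)).card : ℝ) ≤
        ((Finset.univ.filter fun i : Fin m => (1 - α - a) * n ≤ ((Finset.univ.filter
          fun j : Fin n => W D (Sum.inl j) < W D (Sum.inr i)).card : ℝ)).card : ℝ) +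
        ((Finset.univ.filter fun i : Fin m => a * n <
          ((Finset.univ.filter fun j : Fin n => γ < A.discrepancy j i D).card : ℝ)).card : ℝ) := by
      exact_mod_cast c3
    -- Missed test points: a fraction below `1 - τ + 2ε = α + a + 2ε` by ranks, plus at most `a`
    -- with too many bad partners. `E₄` adds the third `ε`.
    have c5 : (P.real (A.missSet α γ (D ∘ Sum.inl)) - ε) * m <
        (α + 2 * a + 2 * ε) * m := by
      have : (α + 2 * a + 2 * ε) * m = (1 - (1 - α - a) + 2 * ε) * m + a * m := by ring
      linarith
    have c6 := lt_of_mul_lt_mul_right c5 hm'.le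
    linarith
  have hmp := measurePreserving_comp_injective P (Sum.inl_injective (α := Fin n) (β := Fin m))
  calc iidLaw P n {D | ENNReal.ofReal (α + 3 * ε + 2 * a) ≤ A.miscoverage P α γ D}
      ≤ iidLaw P n {D | ENNReal.ofReal (α + 3 * ε + 2 * a) ≤ P (A.missSet α γ D)} :=
        measure_mono fun D hD => le_trans hD (hmis D)
    _ = (Measure.pi fun _ => P) ((fun D : Fin n ⊕ Fin m → 𝒳 × ℝ => D ∘ Sum.inl) ⁻¹'
          {D : Fin n → 𝒳 × ℝ | ENNReal.ofReal (α + 3 * ε + 2 * a) ≤ P (A.missSet α γ D)}) :=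
        (hmp.measure_preimage hT.nullMeasurableSet).symm
    _ ≤ (Measure.pi fun _ => P) (E₁ ∪ (E₂ ∪ (E₃ ∪ E₄))) := measure_mono hsub
    _ ≤ ENNReal.ofReal a + (ENNReal.ofReal δ + (ENNReal.ofReal δ + ENNReal.ofReal δ)) := by
        refine (measure_union_le _ _).trans (add_le_add h1 ?_)
        refine (measure_union_le _ _).trans (add_le_add h2 ?_)
        exact (measure_union_le _ _).trans (add_le_add h3 h4)
    _ = ENNReal.ofReal (3 * δ + a) := by
        rw [← ENNReal.ofReal_add hδ0.le hδ0.le, ← ENNReal.ofReal_add hδ0.le (by positivity),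
          ← ENNReal.ofReal_add ha (by positivity)]
        congr 1
        ring

end Main

/-! ### Finite-sample bounds, with and without inflation -/

section FiniteSample

variable {𝒳 : Type*} [MeasurableSpace 𝒳]

theorem quantile_lt_coe_iff {n : ℕ} {v : Fin n → ℝ} {τ y : ℝ} :
    quantile v τ < (y : EReal) ↔ τ * n ≤ ((Finset.univ.filter fun i => v i < y).card : ℝ) := by
  constructor
  · intro h
    simpa only [EReal.coe_lt_coe_iff] using le_card_lt_of_quantile_lt h
  · intro h
    -- The witness is the largest value below `y`, or `⊥` when there is none.
    refine sInf_lt_iff.2 ⟨(Finset.univ.filter fun i => v i < y).sup fun i => (v i : EReal), ?_, ?_⟩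
    · rw [Set.mem_ofPred_eq]
      refine h.trans ?_
      rw [Nat.card_eq_fintype_card, Fintype.card_subtype]
      norm_cast
      refine Finset.card_le_card fun i hi => ?_
      rw [Finset.mem_filter]
      exact ⟨Finset.mem_univ _, Finset.le_sup (f := fun i => (v i : EReal)) hi⟩
    · rw [Finset.sup_lt_iff (EReal.bot_lt_coe y)]
      intro i hi
      exact EReal.coe_lt_coe_iff.2 (Finset.mem_filter.1 hi).2

theorem coe_lt_neg_sub_coe_iff (q : EReal) (y γ : ℝ) :
    (y : EReal) < -q - (γ : EReal) ↔ q < ((-y - γ : ℝ) : EReal) := by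
  induction q with
  | bot =>
    refine iff_of_true ?_ (EReal.bot_lt_coe _)
    rw [EReal.neg_bot, EReal.top_sub_coe]
    exact EReal.coe_lt_top y
  | top => simp
  | coe q => norm_cast; constructor <;> intro h <;> linarith

theorem add_coe_lt_coe_iff (q : EReal) (y γ : ℝ) :
    q + (γ : EReal) < (y : EReal) ↔ q < ((y - γ : ℝ) : EReal) := by
  induction q with
  | bot =>
    refine iff_of_true ?_ (EReal.bot_lt_coe _)
    rw [EReal.bot_add]
    exact EReal.bot_lt_coe y
  | top => simp
  | coe q => norm_cast; constructor <;> intro h <;> linarith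

namespace RegressionAlgorithm

variable (A : RegressionAlgorithm 𝒳)

theorem notMem_jackknifePlus_iff {n : ℕ} {α γ : ℝ} {D : Fin n → 𝒳 × ℝ} {x : 𝒳} {y : ℝ} :
    y ∉ A.jackknifePlus α γ D x ↔
      quantile (fun i => -A.looFit D i x + A.looResidual D i) ((1 - α) * (1 + 1 / (n : ℝ))) <
        ((-y - γ : ℝ) : EReal) ∨
      quantile (fun i => A.looFit D i x + A.looResidual D i) ((1 - α) * (1 + 1 / (n : ℝ))) <
        ((y - γ : ℝ) : EReal) := by
  simp only [jackknifePlus, Set.mem_ofPred_eq, not_and_or, not_le, coe_lt_neg_sub_coe_iff,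
    add_coe_lt_coe_iff]

theorem measurableSet_notMem_jackknifePlus {n : ℕ} (α γ : ℝ) (D : Fin n → 𝒳 × ℝ) :
    MeasurableSet {z : 𝒳 × ℝ | z.2 ∉ A.jackknifePlus α γ D z.1} := by
  have hfit (j : Fin n) : Measurable fun z : 𝒳 × ℝ => A.looFit D j z.1 :=
    (A.measurable_looFit j).comp (measurable_const.prodMk measurable_fst)
  simp only [notMem_jackknifePlus_iff, quantile_lt_coe_iff]
  refine MeasurableSet.union ?_ ?_
  · exact measurableSet_le measurable_const (measurable_card_filter _ fun j =>
      measurableSet_lt ((hfit j).neg.add_const _) (measurable_snd.neg.sub_const _))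
  · exact measurableSet_le measurable_const (measurable_card_filter _ fun j =>
      measurableSet_lt ((hfit j).add_const _) (measurable_snd.sub_const _))

end RegressionAlgorithm

/-- Raising a finite endpoint `q` by `γ` gains only `(q, q + γ]`; an infinite endpoint gains
nothing. -/
theorem volume_shell_le (q : EReal) (γ : ℝ) :
    volume {y : ℝ | q < (y : EReal) ∧ ¬ q < ((y - γ : ℝ) : EReal)} ≤ ENNReal.ofReal γ := by
  induction q with
  | bot =>
    have : {y : ℝ | ⊥ < (y : EReal) ∧ ¬ ⊥ < ((y - γ : ℝ) : EReal)} = ∅ :=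
      Set.eq_empty_of_forall_notMem fun y hy => hy.2 (EReal.bot_lt_coe _)
    rw [this, measure_empty]
    exact zero_le
  | top => simp
  | coe q =>
    have : {y : ℝ | (q : EReal) < (y : EReal) ∧ ¬ (q : EReal) < ((y - γ : ℝ) : EReal)} ⊆
        Set.Ioc q (q + γ) := by
      intro y hy
      simp only [Set.mem_ofPred_eq, EReal.coe_lt_coe_iff, not_lt] at hy
      exact ⟨hy.1, by linarith [hy.2]⟩
    refine (measure_mono this).trans ?_
    rw [Real.volume_Ioc]
    simp

theorem IsCondDensity.measure_le {P : Measure (𝒳 × ℝ)} [IsProbabilityMeasure P]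
    {f : 𝒳 → ℝ → ℝ≥0∞} (hf : IsCondDensity P f) {S : Set (𝒳 × ℝ)} (hS : MeasurableSet S)
    {r : ℝ≥0∞} (hr : r ≠ ∞) (hvol : ∀ x, volume {y : ℝ | (x, y) ∈ S} ≤ r) :
    P S ≤ expSupDensity P f * r := by
  have h1 : P S = ∫⁻ x, ∫⁻ y, S.indicator (Function.uncurry f) (x, y) ∂volume ∂P.fst := by
    conv_lhs => rw [hf.2]
    rw [withDensity_apply _ hS, ← lintegral_indicator hS,
      lintegral_prod _ (hf.1.indicator hS).aemeasurable]
  rw [h1, expSupDensity, ← lintegral_mul_const' _ _ hr]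
  refine lintegral_mono fun x => ?_
  have hsec : MeasurableSet {y : ℝ | (x, y) ∈ S} := hS.preimage measurable_prodMk_left
  calc ∫⁻ y, S.indicator (Function.uncurry f) (x, y) ∂volume
      ≤ ∫⁻ y, {y : ℝ | (x, y) ∈ S}.indicator (fun _ => ⨆ y : ℝ, f x y) y ∂volume := by
        refine lintegral_mono fun y => ?_
        by_cases h : (x, y) ∈ S
        · rw [Set.indicator_of_mem h, Set.indicator_of_mem (show y ∈ {y : ℝ | (x, y) ∈ S} from h)]
          exact le_iSup (f x) y
        · simp [h]
    _ = (⨆ y : ℝ, f x y) * volume {y : ℝ | (x, y) ∈ S} := lintegral_indicator_const hsec _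
    _ ≤ (⨆ y : ℝ, f x y) * r := by gcongr; exact hvol x

/-- Otherwise every bounded strip in `y` would be null, and these strips exhaust the space. -/
theorem IsCondDensity.expSupDensity_ne_zero {P : Measure (𝒳 × ℝ)} [IsProbabilityMeasure P]
    {f : 𝒳 → ℝ → ℝ≥0∞} (hf : IsCondDensity P f) : expSupDensity P f ≠ 0 := by
  intro h0
  have h1 : ∀ k : ℕ, P {z | z.2 ∈ Set.Icc (-(k : ℝ)) k} = 0 := by
    intro k
    have h := hf.measure_le (S := {z | z.2 ∈ Set.Icc (-(k : ℝ)) k})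
      (measurableSet_Icc.preimage measurable_snd)
      (r := volume (Set.Icc (-(k : ℝ)) k)) (by simp [Real.volume_Icc]) (fun x => le_rfl)
    rw [h0, zero_mul] at h
    exact le_antisymm h zero_le
  have h2 : (⋃ k : ℕ, {z : 𝒳 × ℝ | z.2 ∈ Set.Icc (-(k : ℝ)) k}) = Set.univ := by
    refine Set.eq_univ_of_forall fun z => Set.mem_iUnion.2 ?_
    obtain ⟨k, hk⟩ := exists_nat_ge |z.2|
    exact ⟨k, abs_le.1 hk⟩
  have h3 : P Set.univ = 0 := by
    rw [← h2]
    exact measure_iUnion_null h1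
  simp at h3

namespace RegressionAlgorithm

variable (A : RegressionAlgorithm 𝒳)

/-- For each `x`, deflating the interval loses at most two shells of length `γ`, one at each end. -/
theorem miscoverage_zero_le (P : Measure (𝒳 × ℝ)) [IsProbabilityMeasure P] {f : 𝒳 → ℝ → ℝ≥0∞}
    (hf : IsCondDensity P f) {n : ℕ} (α : ℝ) {γ : ℝ} (D : Fin n → 𝒳 × ℝ) :
    A.miscoverage P α 0 D ≤
      A.miscoverage P α γ D + expSupDensity P f * (2 * ENNReal.ofReal γ) := by
  set S : Set (𝒳 × ℝ) := {z | z.2 ∉ A.jackknifePlus α 0 D z.1} \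
    {z | z.2 ∉ A.jackknifePlus α γ D z.1} with hS
  have hSm : MeasurableSet S := (A.measurableSet_notMem_jackknifePlus α 0 D).diff
    (A.measurableSet_notMem_jackknifePlus α γ D)
  have hvol : ∀ x, volume {y : ℝ | (x, y) ∈ S} ≤ 2 * ENNReal.ofReal γ := by
    intro x
    set q₁ := quantile (fun i => -A.looFit D i x + A.looResidual D i)
      ((1 - α) * (1 + 1 / (n : ℝ)))
    set q₂ := quantile (fun i => A.looFit D i x + A.looResidual D i)
      ((1 - α) * (1 + 1 / (n : ℝ)))
    have hsub : {y : ℝ | (x, y) ∈ S} ⊆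
        (Neg.neg ⁻¹' {y : ℝ | q₁ < (y : EReal) ∧ ¬ q₁ < ((y - γ : ℝ) : EReal)}) ∪
        {y : ℝ | q₂ < (y : EReal) ∧ ¬ q₂ < ((y - γ : ℝ) : EReal)} := by
      intro y hy
      obtain ⟨hy0, hy1⟩ := hy
      simp only [Set.mem_ofPred_eq, notMem_jackknifePlus_iff, sub_zero, not_or] at hy0 hy1
      rcases hy0 with h | h
      · exact Or.inl ⟨h, hy1.1⟩
      · exact Or.inr ⟨h, hy1.2⟩
    refine (measure_mono hsub).trans ((measure_union_le _ _).trans ?_)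
    rw [two_mul]
    refine add_le_add ?_ (volume_shell_le _ _)
    rw [Measure.measure_preimage_neg]
    exact volume_shell_le _ _
  calc A.miscoverage P α 0 D
      ≤ P ({z | z.2 ∉ A.jackknifePlus α γ D z.1} ∪ S) := by
        refine measure_mono ?_
        rw [hS, Set.union_sdiff_self]
        exact Set.subset_union_right
    _ ≤ A.miscoverage P α γ D + P S := measure_union_le _ _
    _ ≤ _ := by
        gcongr
        exact hf.measure_le hSm (by finiteness) hvol

theorem measure_le_miscoverage_le_ennreal (P : Measure (𝒳 × ℝ)) [IsProbabilityMeasure P] {n m : ℕ}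
    (hm : 0 < m) (hmn : m ≤ n - 1) {α γ δ : ℝ} {a : ℝ≥0∞} (hα0 : 0 ≤ α) (hα1 : α ≤ 1)
    (hδ0 : 0 < δ) (hδ1 : δ < 1)
    (hbad : ∀ (j : Fin n) (i : Fin m), (Measure.pi fun _ => P)
      {D : Fin n ⊕ Fin m → 𝒳 × ℝ | γ < A.discrepancy j i D} ≤ a ^ 3) :
    iidLaw P n {D | ENNReal.ofReal α +
        ENNReal.ofReal (3 * √(Real.log (1 / δ) / (2 * (min n m : ℕ)))) + 2 * a ≤
          A.miscoverage P α γ D} ≤ 3 * ENNReal.ofReal δ + a := by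
  rcases eq_or_ne a ∞ with rfl | ha
  · simp
  lift a to NNReal using ha
  have h := A.measure_le_miscoverage_le P hm hmn hα0 hα1 hδ0 hδ1 (a := a) (γ := γ) a.coe_nonneg (by
    intro j i
    rw [ENNReal.ofReal_pow a.coe_nonneg, ENNReal.ofReal_coe_nnreal]
    exact hbad j i)
  rw [ENNReal.ofReal_add (by positivity) (by positivity),
    ENNReal.ofReal_add (by positivity) (by positivity),
    ENNReal.ofReal_add (by positivity) a.coe_nonneg, ENNReal.ofReal_mul (by positivity) (q := (a : ℝ)),
    ENNReal.ofReal_mul (by positivity) (q := δ), ENNReal.ofReal_coe_nnreal] at h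
  simpa only [ENNReal.ofReal_ofNat] using h

theorem measure_discrepancy_gt_le (P : Measure (𝒳 × ℝ)) [IsProbabilityMeasure P] {n m : ℕ}
    (hmn : m ≤ n - 1) {γ : ℝ} (hγ : 0 < γ) {s : ℝ≥0∞} (hs : swapStability A P m (n - 1) ≤ s)
    (j : Fin n) (i : Fin m) :
    (Measure.pi fun _ => P) {D : Fin n ⊕ Fin m → 𝒳 × ℝ | γ < A.discrepancy j i D} ≤
      2 * s / ENNReal.ofReal γ := by
  have h1 : {D : Fin n ⊕ Fin m → 𝒳 × ℝ | γ < A.discrepancy j i D} ⊆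
      {D | ENNReal.ofReal γ ≤ ENNReal.ofReal (A.discrepancy j i D)} := by
    intro D hD
    rw [Set.mem_ofPred_eq] at hD ⊢
    exact ENNReal.ofReal_le_ofReal hD.le
  refine (measure_mono h1).trans ?_
  refine (meas_ge_le_lintegral_div (A.measurable_discrepancy j i).ennreal_ofReal.aemeasurable
    (by simpa using hγ) ENNReal.ofReal_ne_top).trans ?_
  gcongr
  refine (A.lintegral_discrepancy_le P hmn j i).trans ?_
  gcongr

theorem inflated_bound (P : Measure (𝒳 × ℝ)) [IsProbabilityMeasure P] {n m : ℕ}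
    (hm : 0 < m) (hmn : m ≤ n - 1) {α γ δ : ℝ} (hα0 : 0 ≤ α) (hα1 : α ≤ 1)
    (hγ : 0 < γ) (hδ0 : 0 < δ) (hδ1 : δ < 1) {s : ℝ≥0∞}
    (hs : swapStability A P m (n - 1) ≤ s) :
    iidLaw P n {D | ENNReal.ofReal α +
        ENNReal.ofReal (3 * √(Real.log (1 / δ) / (2 * (min n m : ℕ)))) +
          2 * (2 * s / ENNReal.ofReal γ) ^ (1 / 3 : ℝ) ≤ A.miscoverage P α γ D} ≤
      3 * ENNReal.ofReal δ + (2 * s / ENNReal.ofReal γ) ^ (1 / 3 : ℝ) := by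
  refine A.measure_le_miscoverage_le_ennreal P hm hmn hα0 hα1 hδ0 hδ1 fun j i => ?_
  rw [← ENNReal.rpow_natCast, ← ENNReal.rpow_mul]
  norm_num
  exact A.measure_discrepancy_gt_le P hmn hγ hs j i

/-- With `c = (2 B s)^(1/4)` and `γ = 2 s / c³`, Markov gives `2 s / γ = c³`, so `a = c`, while the
shells cost `2 B γ = 2 c`. The total is `2 c + 2 c`. -/
theorem density_bound (P : Measure (𝒳 × ℝ)) [IsProbabilityMeasure P] {n m : ℕ}
    (hm : 0 < m) (hmn : m ≤ n - 1) {α δ : ℝ} (hα0 : 0 ≤ α) (hα1 : α ≤ 1)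
    (hδ0 : 0 < δ) (hδ1 : δ < 1) {f : 𝒳 → ℝ → ℝ≥0∞} (hf : IsCondDensity P f) {s B : ℝ≥0∞}
    (hs : swapStability A P m (n - 1) ≤ s) (hB : expSupDensity P f ≤ B) :
    iidLaw P n {D | ENNReal.ofReal α +
        ENNReal.ofReal (3 * √(Real.log (1 / δ) / (2 * (min n m : ℕ)))) +
          4 * (2 * B * s) ^ (1 / 4 : ℝ) ≤ A.miscoverage P α 0 D} ≤
      3 * ENNReal.ofReal δ + (2 * B * s) ^ (1 / 4 : ℝ) := by
  have hB0 : B ≠ 0 := fun h => hf.expSupDensity_ne_zero (le_antisymm (h ▸ hB) zero_le)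
  rcases eq_or_ne s 0 with rfl | hs0
  -- With `s = 0` the discrepancy vanishes almost surely, so `γ = 0` and `a = 0` are allowed and no
  -- density bound is needed; this covers `B = ∞`.
  · have h := A.measure_le_miscoverage_le_ennreal P hm hmn (γ := 0) (a := 0) hα0 hα1 hδ0 hδ1 (by
      intro j i
      have h0 : ∫⁻ D, ENNReal.ofReal (A.discrepancy j i D) ∂(Measure.pi fun _ => P) = 0 := by
        refine le_antisymm ((A.lintegral_discrepancy_le P hmn j i).trans ?_) zero_le
        rw [le_antisymm hs zero_le, mul_zero]
      rw [lintegral_eq_zero_iff (A.measurable_discrepancy j i).ennreal_ofReal] at h0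
      rw [zero_pow (by norm_num), nonpos_iff_eq_zero]
      refine measure_mono_null (fun D hD => ?_) (ae_iff.1 h0)
      rw [Set.mem_ofPred_eq] at hD ⊢
      simpa using hD)
    simpa using h
  set c : ℝ≥0∞ := (2 * B * s) ^ (1 / 4 : ℝ) with hc
  have hprod0 : 2 * B * s ≠ 0 := mul_ne_zero (mul_ne_zero (by norm_num) hB0) hs0
  rcases eq_or_ne c ∞ with hct | hct
  · rw [hct]; simp
  have hc4 : c ^ 4 = 2 * B * s := by
    rw [hc, ← ENNReal.rpow_natCast, ← ENNReal.rpow_mul]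
    norm_num
  have hpt : 2 * B * s ≠ ∞ := by
    rw [← hc4]
    exact ENNReal.pow_ne_top hct
  have hc0 : c ≠ 0 := by
    intro h
    rw [h, zero_pow (by norm_num)] at hc4
    exact hprod0 hc4.symm
  have hst : s ≠ ∞ := by
    rintro rfl
    exact hpt (ENNReal.mul_top (mul_ne_zero (by norm_num) hB0))
  have hc3 : c ^ 3 ≠ 0 := pow_ne_zero _ hc0
  have hc3t : c ^ 3 ≠ ∞ := ENNReal.pow_ne_top hct
  set g : ℝ≥0∞ := 2 * s / c ^ 3 with hg
  have hg0 : g ≠ 0 := ENNReal.div_ne_zero.2 ⟨mul_ne_zero (by norm_num) hs0, hc3t⟩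
  have hgt : g ≠ ∞ := ENNReal.div_ne_top (ENNReal.mul_ne_top (by norm_num) hst) hc3
  have hγ : 0 < g.toReal := ENNReal.toReal_pos hg0 hgt
  have hgγ : ENNReal.ofReal g.toReal = g := ENNReal.ofReal_toReal hgt
  have hgc : g * c ^ 3 = 2 * s := ENNReal.div_mul_cancel hc3 hc3t
  have hratio : 2 * s / g = c ^ 3 := by
    rw [← hgc, mul_comm, ENNReal.mul_div_cancel_right hg0 hgt]
  have hshell : B * (2 * g) = 2 * c := by
    have : B * (2 * g) * c ^ 3 = 2 * c * c ^ 3 := by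
      calc B * (2 * g) * c ^ 3 = 2 * B * (g * c ^ 3) := by ring
        _ = 2 * (2 * B * s) := by rw [hgc]; ring
        _ = 2 * c * c ^ 3 := by rw [← hc4]; ring
    exact (ENNReal.mul_left_inj hc3 hc3t).1 this
  have h := A.measure_le_miscoverage_le_ennreal P hm hmn (γ := g.toReal) (a := c) hα0 hα1 hδ0 hδ1
    (by
      intro j i
      have := A.measure_discrepancy_gt_le P hmn hγ hs j i
      rwa [hgγ, hratio] at this)
  refine (measure_mono fun D hD => ?_).trans h
  rw [Set.mem_ofPred_eq] at hD ⊢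
  have h2 := (hD.trans (A.miscoverage_zero_le P hf α (γ := g.toReal) D)).trans
    (add_le_add_right (mul_le_mul_left hB _) _)
  rw [hgγ, hshell, show (4 : ℝ≥0∞) * c = 2 * c + 2 * c by ring, ← add_assoc] at h2
  exact (ENNReal.add_le_add_iff_right (ENNReal.mul_ne_top (by norm_num) hct)).1 h2

end RegressionAlgorithm

/-- Subadditivity alone suffices, so `g` need not be measurable. -/
theorem le_measure_lt_of_measure_ge_le {Ω : Type*} [MeasurableSpace Ω] {μ : Measure Ω}
    [IsProbabilityMeasure μ] {g : Ω → ℝ≥0∞} {t u v : ℝ≥0∞} (h : μ {ω | t ≤ g ω} ≤ u + v) :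
    1 - u - v ≤ μ {ω | g ω < t} := by
  rw [tsub_tsub, tsub_le_iff_right, ← measure_univ (μ := μ)]
  have : (Set.univ : Set Ω) ⊆ {ω | g ω < t} ∪ {ω | t ≤ g ω} := fun ω _ =>
    lt_or_ge (g ω) t
  exact (measure_mono this).trans ((measure_union_le _ _).trans (by gcongr))

end FiniteSample

/-! ### Choice of the swap size and the limits -/

section Asymptotic

theorem tendsto_log_succ_div_zero :
    Tendsto (fun m : ℕ => Real.log (m + 1) / (2 * m)) atTop (𝓝 0) := by
  have h1 := Real.tendsto_pow_log_div_mul_add_atTop 2 (-2) 1 (by norm_num)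
  have h2 : Tendsto (fun m : ℕ => (m : ℝ) + 1) atTop atTop :=
    tendsto_natCast_atTop_atTop.atTop_add tendsto_const_nhds
  refine (h1.comp h2).congr fun m => ?_
  simp only [Function.comp_apply, pow_one]
  congr 1
  ring

/-- A swap size `m n → ∞` that grows slowly compared to `1 / r n`, with the error terms of the
finite-sample guarantees that it gives. -/
theorem exists_swap_size {r : ℕ → ℝ} (hr : ∀ n, 0 < r n) (h : Tendsto r atTop (𝓝 0)) (k : ℝ)
    {q : ℝ} (hq : 0 < q) :
    ∃ (m : ℕ → ℕ) (δ ε η : ℕ → ℝ), Tendsto ε atTop (𝓝 0) ∧ Tendsto η atTop (𝓝 0) ∧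
      ∀ᶠ n in atTop, 1 ≤ m n ∧ m n ≤ n - 1 ∧ 0 < δ n ∧ δ n < 1 ∧
        ε n = 3 * √(Real.log (1 / δ n) / (2 * (min n (m n) : ℕ))) +
          k * (2 * (m n * r n)) ^ q ∧
        η n = 3 * δ n + (2 * (m n * r n)) ^ q := by
  -- The cap `1 / √r` gives `m r ≤ √r → 0`, while `m → ∞` still holds.
  let m : ℕ → ℕ := fun n => min (n - 1) ⌊(√(r n))⁻¹⌋₊
  have hsq : Tendsto (fun n => √(r n)) atTop (𝓝 0) := by
    have := (Real.continuous_sqrt.tendsto 0).comp h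
    rwa [Real.sqrt_zero] at this
  have hsqpos : ∀ n, 0 < √(r n) := fun n => Real.sqrt_pos.2 (hr n)
  have hinv : Tendsto (fun n => (√(r n))⁻¹) atTop atTop :=
    Tendsto.inv_tendsto_nhdsGT_zero (tendsto_nhdsWithin_iff.2
      ⟨hsq, Filter.Eventually.of_forall hsqpos⟩)
  have hm : Tendsto m atTop atTop :=
    tendsto_inf_atTop _ (tendsto_sub_atTop_nat 1) (tendsto_nat_floor_atTop.comp hinv)
  have hmr : Tendsto (fun n => (m n : ℝ) * r n) atTop (𝓝 0) := by
    refine squeeze_zero (fun n => mul_nonneg (Nat.cast_nonneg _) (hr n).le) (fun n => ?_) hsq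
    have h1 : (m n : ℝ) ≤ (√(r n))⁻¹ := by
      have h2 : (m n : ℝ) ≤ (⌊(√(r n))⁻¹⌋₊ : ℝ) := Nat.cast_le.2 (min_le_right _ _)
      exact h2.trans (Nat.floor_le (inv_nonneg.2 (hsqpos n).le))
    calc (m n : ℝ) * r n ≤ (√(r n))⁻¹ * r n := mul_le_mul_of_nonneg_right h1 (hr n).le
      _ = (√(r n))⁻¹ * (√(r n) * √(r n)) := by rw [Real.mul_self_sqrt (hr n).le]
      _ = √(r n) := by rw [← mul_assoc, inv_mul_cancel₀ (hsqpos n).ne', one_mul]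
  have hpow : Tendsto (fun n => (2 * (m n * r n)) ^ q) atTop (𝓝 0) := by
    have h1 : Tendsto (fun n => 2 * ((m n : ℝ) * r n)) atTop (𝓝 0) := by
      simpa using hmr.const_mul 2
    have h2 := h1.rpow_const (p := q) (Or.inr hq.le)
    rwa [Real.zero_rpow hq.ne'] at h2
  have hlog : Tendsto (fun n => √(Real.log ((m n : ℝ) + 1) / (2 * m n))) atTop (𝓝 0) := by
    have := (Real.continuous_sqrt.tendsto 0).comp (tendsto_log_succ_div_zero.comp hm)
    rwa [Real.sqrt_zero] at this
  have hδ : Tendsto (fun n => 1 / ((m n : ℝ) + 1)) atTop (𝓝 0) :=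
    tendsto_one_div_add_atTop_nhds_zero_nat.comp hm
  -- `δ = 1 / (m + 1)` tends to `0`, yet `log (1 / δ) / m` does too. None of the choices involves
  -- `α`.
  refine ⟨m, fun n => 1 / ((m n : ℝ) + 1), fun n => 3 * √(Real.log ((m n : ℝ) + 1) / (2 * m n)) +
    k * (2 * (m n * r n)) ^ q, fun n => 3 * (1 / ((m n : ℝ) + 1)) + (2 * (m n * r n)) ^ q,
    ?_, ?_, ?_⟩
  · simpa using (hlog.const_mul 3).add (hpow.const_mul k)
  · simpa using (hδ.const_mul 3).add hpow
  · filter_upwards [hm.eventually_ge_atTop 1] with n hn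
    have hle : m n ≤ n - 1 := min_le_left _ _
    have hpos : (1 : ℝ) ≤ m n := by exact_mod_cast hn
    refine ⟨hn, hle, by positivity, ?_, ?_, rfl⟩
    · rw [div_lt_one (by positivity)]
      linarith
    · rw [one_div_one_div, min_eq_right (show m n ≤ n by omega)]

end Asymptotic

theorem theorem8 {𝒳 : Type*} [MeasurableSpace 𝒳] :
    -- finite-sample guarantee, inflated interval
    (∀ (P : ProbabilityMeasure (𝒳 × ℝ)) (A : RegressionAlgorithm 𝒳) (α : ℝ), 0 ≤ α → α ≤ 1 →
      ∀ (n m : ℕ), 1 ≤ m → m ≤ n - 1 → ∀ (γ δ : ℝ), 0 < γ → 0 < δ → δ < 1 →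
        1 - 3 * ENNReal.ofReal δ
            - (2 * swapStability A P m (n - 1) / ENNReal.ofReal γ) ^ (1 / 3 : ℝ) ≤
          iidLaw (P : Measure (𝒳 × ℝ)) n
            {D | A.miscoverage P α γ D <
              ENNReal.ofReal α
                + ENNReal.ofReal (3 * √(Real.log (1 / δ) / (2 * (min n m : ℕ))))
                + 2 * (2 * swapStability A P m (n - 1) / ENNReal.ofReal γ) ^ (1 / 3 : ℝ)}) ∧
    -- finite-sample guarantee, no inflation, `Y ∣ X` with a density
    (∀ (P : ProbabilityMeasure (𝒳 × ℝ)) (A : RegressionAlgorithm 𝒳) (α : ℝ), 0 ≤ α → α ≤ 1 →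
      ∀ (f : 𝒳 → ℝ → ℝ≥0∞), IsCondDensity (P : Measure (𝒳 × ℝ)) f →
      ∀ (n m : ℕ), 1 ≤ m → m ≤ n - 1 → ∀ (δ : ℝ), 0 < δ → δ < 1 →
        1 - 3 * ENNReal.ofReal δ
            - (2 * expSupDensity P f * swapStability A P m (n - 1)) ^ (1 / 4 : ℝ) ≤
          iidLaw (P : Measure (𝒳 × ℝ)) n
            {D | A.miscoverage P α 0 D <
              ENNReal.ofReal α
                + ENNReal.ofReal (3 * √(Real.log (1 / δ) / (2 * (min n m : ℕ))))
                + 4 * (2 * expSupDensity P f * swapStability A P m (n - 1)) ^ (1 / 4 : ℝ)}) ∧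
    -- asymptotic guarantee, inflated interval
    (∀ (b γ : ℕ → ℝ), (∀ n, 0 < b n) → (∀ n, 0 < γ n) →
      Tendsto (fun n => b n / γ n) atTop (𝓝 0) →
      ∃ ε : ℕ → ℝ, Tendsto ε atTop (𝓝 0) ∧ ∀ (α : ℝ), 0 ≤ α → α ≤ 1 →
        Tendsto (fun n : ℕ =>
          ⨆ (A : RegressionAlgorithm 𝒳) (P : ProbabilityMeasure (𝒳 × ℝ))
            (_ : swapStabilitySup A P (n - 1) ≤ ENNReal.ofReal (b n)),
            iidLaw (P : Measure (𝒳 × ℝ)) n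
              {D | ENNReal.ofReal (α + ε n) ≤ A.miscoverage P α (γ n) D})
          atTop (𝓝 0)) ∧
    -- asymptotic guarantee, no inflation, bounded conditional density
    (∀ (b B : ℕ → ℝ), (∀ n, 0 < b n) → (∀ n, 0 < B n) →
      Tendsto (fun n => b n * B n) atTop (𝓝 0) →
      ∃ ε : ℕ → ℝ, Tendsto ε atTop (𝓝 0) ∧ ∀ (α : ℝ), 0 ≤ α → α ≤ 1 →
        Tendsto (fun n : ℕ =>
          ⨆ (A : RegressionAlgorithm 𝒳) (P : ProbabilityMeasure (𝒳 × ℝ))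
            (_ : HasBoundedCondDensity (P : Measure (𝒳 × ℝ)) (B n))
            (_ : swapStabilitySup A P (n - 1) ≤ ENNReal.ofReal (b n)),
            iidLaw (P : Measure (𝒳 × ℝ)) n
              {D | ENNReal.ofReal (α + ε n) ≤ A.miscoverage P α 0 D})
          atTop (𝓝 0)) := by
  refine ⟨?_, ?_, ?_, ?_⟩
  · intro P A α hα0 hα1 n m hm hmn γ δ hγ hδ0 hδ1
    have : IsProbabilityMeasure (iidLaw (P : Measure (𝒳 × ℝ)) n) := by
      unfold iidLaw; infer_instance
    exact le_measure_lt_of_measure_ge_le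
      (A.inflated_bound P hm hmn hα0 hα1 hγ hδ0 hδ1 le_rfl)
  · intro P A α hα0 hα1 f hf n m hm hmn δ hδ0 hδ1
    have : IsProbabilityMeasure (iidLaw (P : Measure (𝒳 × ℝ)) n) := by
      unfold iidLaw; infer_instance
    exact le_measure_lt_of_measure_ge_le
      (A.density_bound P hm hmn hα0 hα1 hδ0 hδ1 hf le_rfl le_rfl)
  · intro b γ hb hγ hlim
    obtain ⟨m, δ, ε, η, hε, hη, hev⟩ := exists_swap_size (fun n => div_pos (hb n) (hγ n)) hlim 2
      (q := 1 / 3) (by norm_num)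
    refine ⟨ε, hε, fun α hα0 hα1 => ?_⟩
    have hη' : Tendsto (fun n => ENNReal.ofReal (η n)) atTop (𝓝 0) := by
      simpa using ENNReal.tendsto_ofReal hη
    refine tendsto_of_tendsto_of_tendsto_of_le_of_le' tendsto_const_nhds hη'
      (Filter.Eventually.of_forall fun n => zero_le) ?_
    filter_upwards [hev] with n hn
    obtain ⟨hm, hmn, hδ0, hδ1, hεn, hηn⟩ := hn
    refine iSup_le fun A => iSup_le fun P => iSup_le fun hAP => ?_
    -- Swapping one point at a time gives the factor `m`; of the supremum only the term `n' = n - 1`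
    -- is used.
    have hs : swapStability A P (m n) (n - 1) ≤ ENNReal.ofReal (m n * b n) := by
      refine (swapStability_le_mul A P hmn (by omega)).trans ?_
      rw [ENNReal.ofReal_mul (by positivity), ENNReal.ofReal_natCast]
      gcongr
      exact (le_iSup₂ (f := fun (n' : ℕ) (_ : n - 1 ≤ n') => swapStability A P 1 n') (n - 1)
        le_rfl).trans hAP
    have key := A.inflated_bound P hm hmn hα0 hα1 (hγ n) hδ0 hδ1 hs
    have hmb : 0 ≤ m n * b n := mul_nonneg (Nat.cast_nonneg _) (hb n).le
    have hmbγ : 0 ≤ 2 * (m n * (b n / γ n)) :=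
      mul_nonneg zero_le_two (mul_nonneg (Nat.cast_nonneg _) (div_pos (hb n) (hγ n)).le)
    have ha : (2 * ENNReal.ofReal (m n * b n) / ENNReal.ofReal (γ n)) ^ (1 / 3 : ℝ) =
        ENNReal.ofReal ((2 * (m n * (b n / γ n))) ^ (1 / 3 : ℝ)) := by
      rw [← ENNReal.ofReal_rpow_of_nonneg hmbγ (by norm_num), ← ENNReal.ofReal_ofNat 2,
        ← ENNReal.ofReal_mul (by norm_num), ← ENNReal.ofReal_div_of_pos (hγ n), mul_div_assoc,
        mul_div_assoc]
    have hc : 0 ≤ (2 * (m n * (b n / γ n))) ^ (1 / 3 : ℝ) := Real.rpow_nonneg hmbγ _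
    rw [ha] at key
    rw [hεn, hηn, ENNReal.ofReal_add hα0 (by positivity),
      ENNReal.ofReal_add (by positivity) (by positivity), ← add_assoc,
      ENNReal.ofReal_mul zero_le_two, ENNReal.ofReal_add (by positivity) hc,
      ENNReal.ofReal_mul (p := 3) (q := δ n) (by norm_num), ENNReal.ofReal_ofNat 2,
      ENNReal.ofReal_ofNat 3]
    exact key
  · intro b B hb hB hlim
    obtain ⟨m, δ, ε, η, hε, hη, hev⟩ := exists_swap_size (fun n => mul_pos (hb n) (hB n)) hlim 4
      (q := 1 / 4) (by norm_num)
    refine ⟨ε, hε, fun α hα0 hα1 => ?_⟩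
    have hη' : Tendsto (fun n => ENNReal.ofReal (η n)) atTop (𝓝 0) := by
      simpa using ENNReal.tendsto_ofReal hη
    refine tendsto_of_tendsto_of_tendsto_of_le_of_le' tendsto_const_nhds hη'
      (Filter.Eventually.of_forall fun n => zero_le) ?_
    filter_upwards [hev] with n hn
    obtain ⟨hm, hmn, hδ0, hδ1, hεn, hηn⟩ := hn
    refine iSup_le fun A => iSup_le fun P => iSup_le fun ⟨f, hf, hfB⟩ => iSup_le fun hAP => ?_
    have hs : swapStability A P (m n) (n - 1) ≤ ENNReal.ofReal (m n * b n) := by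
      refine (swapStability_le_mul A P hmn (by omega)).trans ?_
      rw [ENNReal.ofReal_mul (by positivity), ENNReal.ofReal_natCast]
      gcongr
      exact (le_iSup₂ (f := fun (n' : ℕ) (_ : n - 1 ≤ n') => swapStability A P 1 n') (n - 1)
        le_rfl).trans hAP
    have key := A.density_bound P hm hmn hα0 hα1 hδ0 hδ1 hf hs hfB
    have hmbB : 0 ≤ 2 * (m n * (b n * B n)) :=
      mul_nonneg zero_le_two (mul_nonneg (Nat.cast_nonneg _) (mul_pos (hb n) (hB n)).le)
    have ha : (2 * ENNReal.ofReal (B n) * ENNReal.ofReal (m n * b n)) ^ (1 / 4 : ℝ) =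
        ENNReal.ofReal ((2 * (m n * (b n * B n))) ^ (1 / 4 : ℝ)) := by
      rw [← ENNReal.ofReal_rpow_of_nonneg hmbB (by norm_num), ← ENNReal.ofReal_ofNat 2,
        ← ENNReal.ofReal_mul (by norm_num),
        ← ENNReal.ofReal_mul (mul_nonneg zero_le_two (hB n).le)]
      congr 2
      ring
    have hc : 0 ≤ (2 * (m n * (b n * B n))) ^ (1 / 4 : ℝ) := Real.rpow_nonneg hmbB _
    rw [ha] at key
    rw [hεn, hηn, ENNReal.ofReal_add hα0 (by positivity),
      ENNReal.ofReal_add (by positivity) (by positivity), ← add_assoc,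
      ENNReal.ofReal_mul (p := 4) (by norm_num), ENNReal.ofReal_add (by positivity) hc,
      ENNReal.ofReal_mul (p := 3) (q := δ n) (by norm_num), ENNReal.ofReal_ofNat 4,
      ENNReal.ofReal_ofNat 3]
    exact key
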